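/- For $n\in\mathbb N$, the $n$-Toffoli gate is the unitary operator on $n+1$ qubits given on the computational basis by \[|x_1,\dots,x_n,t\rangle\mapsto\Big|x_1,\dots,x_n,\;t\oplus\bigwedge_{i=1}^n x_i\Big\rangle .\] Let $\mathcal B_2$ be the gate set consisting of CNOT and all single-qubit unitary gates. The size of a circuit over $\mathcal B_2$ is its number of gates; its depth is the number of time steps needed when gates acting on disjoint sets of qubits may be executed in the same time step. Then the $n$-Toffoli gate can be implemented exactly by a quantum circuit over $\mathcal B_2$ with $1$ clean ancillary qubit, of depth $O(\log n)$ and size $O(n)$. That is, there are circuits $C_n$ over $\mathcal B_2$ ($n\in\mathbb N$), where $C_n$ acts on $n+2$ qubits, such that $C_n(|\psi\rangle\otimes|0\rangle)=(\mathrm{Toffoli}_n|\psi\rangle)\otimes|0\rangle$ for every $n$ and every $(n+1)$-qubit state $|\psi\rangle$, and such that, as $n\to\infty$, $C_n$ has depth $O(\log n)$ and size $O(n)$. -/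

import Mathlib

namespace QuantumCircuit

/-- The gate set `B₂` on a register of qubits labelled by `W`: arbitrary single-qubit unitaries
(`false` labels `|0⟩` and `true` labels `|1⟩`) and CNOT gates on two distinct qubits. -/
inductive Gate (W : Type) where
  | single (w : W) (U : Matrix.unitaryGroup Bool ℂ) : Gate W
  | cnot (control target : W) (h : control ≠ target) : Gate W

/-- The qubits a gate acts on. -/
def Gate.wires {W : Type} [DecidableEq W] : Gate W → Finset W
  | .single w _ => {w}
  | .cnot c t _ => {c, t}

/-- The matrix, in the computational basis, of the permutation operator `|x⟩ ↦ |f x⟩`. -/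
def basisMap {X : Type} [DecidableEq X] (f : X → X) : Matrix X X ℂ :=
  Matrix.of fun y x => if y = f x then 1 else 0

/-- The operator of a gate on the whole register, as a matrix in the computational basis
`|x⟩`, `x : W → Bool`. A single-qubit gate acts on its own qubit and as the identity on all
the others. -/
def Gate.matrix {W : Type} [Fintype W] [DecidableEq W] :
    Gate W → Matrix (W → Bool) (W → Bool) ℂ
  | .single w U => Matrix.of fun y x =>
      if ∀ v, v ≠ w → y v = x v then (U : Matrix Bool Bool ℂ) (y w) (x w) else 0
  | .cnot c t _ => basisMap fun x => Function.update x t (xor (x t) (x c))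

/-- A quantum circuit over `B₂`: the list of its gates, in the order in which they are applied. -/
abbrev Circuit (W : Type) := List (Gate W)

/-- The operator computed by a circuit. -/
def Circuit.matrix {W : Type} [Fintype W] [DecidableEq W] (C : Circuit W) :
    Matrix (W → Bool) (W → Bool) ℂ :=
  C.foldl (fun M g => g.matrix * M) 1

/-- The size of a circuit: its number of gates. -/
def Circuit.size {W : Type} (C : Circuit W) : ℕ := C.length

/-- If `τ w` is the last time step in which qubit `w` has been used, the gate `g` is executed in
the earliest time step after all its qubits have become free; the result is the new table of last
time steps. -/
def Gate.schedule {W : Type} [DecidableEq W] (τ : W → ℕ) (g : Gate W) : W → ℕ :=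
  fun w => if w ∈ g.wires then g.wires.sup τ + 1 else τ w

/-- The depth of a circuit: the number of time steps needed when gates on disjoint sets of qubits
may be executed in the same time step (each gate, in turn, being executed as early as
possible). -/
def Circuit.depth {W : Type} [Fintype W] [DecidableEq W] (C : Circuit W) : ℕ :=
  Finset.univ.sup (C.foldl Gate.schedule fun _ => 0)

/-- The state `|ψ⟩ ⊗ |0 … 0⟩`: data qubits `Q` in state `ψ`, ancillary qubits `A` all in
state `|0⟩`. -/
def withZeros {Q A : Type} [Fintype A] (ψ : (Q → Bool) → ℂ) : (Q ⊕ A → Bool) → ℂ :=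
  fun x => if ∀ a, x (Sum.inr a) = false then ψ fun q => x (Sum.inl q) else 0

/-- The circuit `C` on data qubits `Q` and ancillary qubits `A` implements the operator `U` on the
data qubits exactly, with the qubits in `A` as clean ancillas: they start in `|0⟩` and are
returned to `|0⟩`. -/
def Circuit.ImplementsClean {Q A : Type} [Fintype Q] [DecidableEq Q] [Fintype A] [DecidableEq A]
    (C : Circuit (Q ⊕ A)) (U : Matrix (Q → Bool) (Q → Bool) ℂ) : Prop :=
  ∀ ψ : (Q → Bool) → ℂ, C.matrix.mulVec (withZeros ψ) = withZeros (U.mulVec ψ)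

/-- The `n`-Toffoli gate `|x₁, …, xₙ, t⟩ ↦ |x₁, …, xₙ, t ⊕ (x₁ ∧ ⋯ ∧ xₙ)⟩`; the last of the
`n + 1` qubits is the target. -/
def toffoli (n : ℕ) : Matrix (Fin (n + 1) → Bool) (Fin (n + 1) → Bool) ℂ :=
  basisMap fun x => Function.update x (Fin.last n)
    (xor (x (Fin.last n)) (decide (∀ i : Fin n, x i.castSucc = true)))

end QuantumCircuit

namespace QuantumCircuit

/-! The quantum content is confined to one gate: a Toffoli gate on two controls costs 19 gates of
`B₂` (`ccxCircuit_matrix`). NOT, CNOT and this gate permute basis states, so it suffices to find a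
reversible bit circuit of linear length and logarithmic depth with one clean bit.

Clean workspace is manufactured from the controls. After `u ∧ v` has been added to a zero bit `w`,
flip `u` and `v`: if the conjunction held, both are now zero and can serve as workspace. If some
conjunction failed, the failure reaches a root bit that no later stage of the reduction touches, so
the overall conjunction is already known to be false and any later garbage is harmless.

Starting from one ancilla, stage `k` evaluates a binary tree on `2 ^ k` new controls whose internal
nodes are the `2 ^ k - 1` tree controls cleared so far. The number of controls absorbed thus doubles
at each stage, and with `K` stages and one last partial tree the conjunction of all controls becomes
that of at most `K + 1` live bits (`run_reduceCircuit`), where `2 ^ K ≤ n + 1`. A ladder of length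
linear in `K`, borrowing bits of arbitrary value, adds this conjunction to the target
(`run_multiControlledNot`); the reduction is then undone.

A single tree has depth of order `k`, so running the stages one after another would only give `K ^
2`. They overlap instead: the deep nodes of a tree are released first, and they are the ones the
next tree needs first. This is the weight `2 * Nat.log 2 i` in `finish_heapCircuit_le`, by which
each stage delays the schedule by a constant only (`finish_stages_le`). -/

theorem xor_update_involutive {W : Type} [DecidableEq W] {c t : W} (h : c ≠ t) :
    Function.Involutive fun x : W → Bool => Function.update x t (xor (x t) (x c)) := by
  intro x
  ext v
  by_cases hv : v = t
  · subst hv; simp [h]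
  · simp [hv]

/-! ### Operators of circuits, and the two-control Toffoli gate over `B₂`. -/

section Operators

variable {W : Type} [Fintype W] [DecidableEq W]

theorem Circuit.foldl_matrix (C : Circuit W) (M : Matrix (W → Bool) (W → Bool) ℂ) :
    C.foldl (fun M g => g.matrix * M) M = Circuit.matrix C * M := by
  unfold Circuit.matrix
  induction C generalizing M with
  | nil => simp
  | cons g C ih =>
    simp only [List.foldl_cons]
    rw [ih, ih (g.matrix * 1), Matrix.mul_one, Matrix.mul_assoc]

theorem Circuit.matrix_nil : Circuit.matrix ([] : Circuit W) = 1 := rfl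

theorem Circuit.matrix_cons (g : Gate W) (C : Circuit W) :
    Circuit.matrix (g :: C) = Circuit.matrix C * g.matrix := by
  have := Circuit.foldl_matrix C (g.matrix * 1)
  rw [Matrix.mul_one] at this
  rw [← this]
  simp [Circuit.matrix]

theorem Circuit.matrix_append (C D : Circuit W) :
    Circuit.matrix (C ++ D) = Circuit.matrix D * Circuit.matrix C := by
  induction C with
  | nil => simp [Circuit.matrix_nil]
  | cons g C ih => rw [List.cons_append, matrix_cons, matrix_cons, ih, Matrix.mul_assoc]

theorem basisMap_mulVec_of_involutive {X : Type} [Fintype X] [DecidableEq X] {f : X → X}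
    (hf : Function.Involutive f) (ψ : X → ℂ) (y : X) : (basisMap f).mulVec ψ y = ψ (f y) := by
  have h : ∀ x, (y = f x) ↔ (f y = x) := fun x => ⟨fun h => by rw [h, hf], fun h => by rw [← h, hf]⟩
  simp [basisMap, Matrix.mulVec, dotProduct, h]

theorem basisMap_id {X : Type} [DecidableEq X] : basisMap (id : X → X) = 1 := by
  ext y x
  simp [basisMap, Matrix.one_apply]

theorem basisMap_mul {X : Type} [Fintype X] [DecidableEq X] (f g : X → X) :
    basisMap f * basisMap g = basisMap (f ∘ g) := by
  ext y x
  simp [basisMap, Matrix.mul_apply]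

theorem Gate.cnot_mulVec {c t : W} (h : c ≠ t) (ψ : (W → Bool) → ℂ) (y : W → Bool) :
    (Gate.cnot c t h).matrix.mulVec ψ y = ψ (Function.update y t (xor (y t) (y c))) :=
  basisMap_mulVec_of_involutive (xor_update_involutive h) ψ y

theorem Gate.single_mulVec (w : W) (U : Matrix.unitaryGroup Bool ℂ) (ψ : (W → Bool) → ℂ)
    (y : W → Bool) :
    (Gate.single w U).matrix.mulVec ψ y =
      ∑ b : Bool, (U : Matrix Bool Bool ℂ) (y w) b * ψ (Function.update y w b) := by
  simp only [Gate.matrix, Matrix.mulVec, dotProduct, Matrix.of_apply, ite_mul, zero_mul]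
  rw [← Finset.sum_filter]
  refine Finset.sum_bij' (fun x _ => x w) (fun b _ => Function.update y w b) ?_ ?_ ?_ ?_ ?_
  · simp
  · intro b _
    simp only [Finset.mem_filter, Finset.mem_univ, true_and]
    intro v hv
    simp [hv]
  · intro x hx
    simp only [Finset.mem_filter, Finset.mem_univ, true_and] at hx
    ext v
    by_cases hv : v = w
    · subst hv; simp
    · simp [hv, hx v hv]
  · simp
  · intro x hx
    simp only [Finset.mem_filter, Finset.mem_univ, true_and] at hx
    congr 2
    ext v
    by_cases hv : v = w
    · subst hv; simp
    · simp [hv, hx v hv]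

/-- The phase gate `|0⟩ ↦ |0⟩`, `|1⟩ ↦ u |1⟩`. -/
def phaseGate (u : Circle) : Matrix.unitaryGroup Bool ℂ :=
  ⟨Matrix.diagonal fun b => if b then (u : ℂ) else 1, by
    rw [Matrix.mem_unitaryGroup_iff, Matrix.star_eq_conjTranspose, Matrix.diagonal_conjTranspose,
      Matrix.diagonal_mul_diagonal]
    ext i j
    cases i <;> cases j <;> simp [Complex.mul_conj]⟩

/-- The Hadamard gate. -/
noncomputable def hadamardGate : Matrix.unitaryGroup Bool ℂ :=
  ⟨Matrix.of fun i j => if i && j then -((√2 : ℝ) : ℂ)⁻¹ else ((√2 : ℝ) : ℂ)⁻¹, by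
    have h : (((√2 : ℝ) : ℂ)⁻¹) * (((√2 : ℝ) : ℂ)⁻¹) = 1 / 2 := by
      rw [← mul_inv, ← Complex.ofReal_mul, Real.mul_self_sqrt (by norm_num)]; norm_num
    rw [Matrix.mem_unitaryGroup_iff, Matrix.star_eq_conjTranspose]
    ext i j
    cases i <;> cases j <;>
      simp [Matrix.mul_apply, Matrix.conjTranspose_apply, h]; norm_num⟩

/-- The Pauli `X` gate. -/
def notGate : Matrix.unitaryGroup Bool ℂ :=
  ⟨Matrix.of fun i j => if i = j then 0 else 1, by
    rw [Matrix.mem_unitaryGroup_iff, Matrix.star_eq_conjTranspose]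
    ext i j
    cases i <;> cases j <;> simp [Matrix.mul_apply, Matrix.conjTranspose_apply]⟩

theorem mulVec_injective_ext {X : Type} [Fintype X] [DecidableEq X] {M N : Matrix X X ℂ}
    (h : ∀ ψ y, M.mulVec ψ y = N.mulVec ψ y) : M = N := by
  ext y x
  have := h (Pi.single x 1) y
  simpa using this

theorem notGate_matrix (w : W) :
    (Gate.single w notGate).matrix = basisMap fun x => Function.update x w (!x w) := by
  refine mulVec_injective_ext fun ψ y => ?_
  rw [Gate.single_mulVec, basisMap_mulVec_of_involutive]
  · cases h : y w <;> simp [notGate]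
  · intro x
    simp

/-- The circuit multiplies each basis state `|y⟩` by `d y`. -/
def Circuit.ActsDiagonally (C : Circuit W) (d : (W → Bool) → ℂ) : Prop :=
  ∀ ψ y, (Circuit.matrix C).mulVec ψ y = d y * ψ y

theorem Circuit.ActsDiagonally.append {C D : Circuit W} {d e : (W → Bool) → ℂ}
    (hC : C.ActsDiagonally d) (hD : D.ActsDiagonally e) :
    Circuit.ActsDiagonally (C ++ D) fun y => e y * d y := by
  intro ψ y
  rw [Circuit.matrix_append, ← Matrix.mulVec_mulVec, hD, hC, mul_assoc]

theorem actsDiagonally_phase (w : W) (u : Circle) :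
    Circuit.ActsDiagonally [Gate.single w (phaseGate u)] fun y => if y w then (u : ℂ) else 1 := by
  intro ψ y
  rw [Circuit.matrix_cons, Circuit.matrix_nil, Matrix.one_mul, Gate.single_mulVec]
  have : Function.update y w (y w) = y := by simp
  cases h : y w <;> rw [h] at this <;> simp [phaseGate, this, h]

/-- Conjugation by CNOT turns a phase depending on the bit `t` into one depending on the parity `t ⊕
c`; this produces the parity terms of the phase polynomial. -/
theorem Circuit.ActsDiagonally.conj_cnot {C : Circuit W} {d : (W → Bool) → ℂ}
    (hC : C.ActsDiagonally d) {c t : W} (h : c ≠ t) :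
    Circuit.ActsDiagonally (Gate.cnot c t h :: C ++ [Gate.cnot c t h])
      fun y => d (Function.update y t (xor (y t) (y c))) := by
  intro ψ y
  rw [Circuit.matrix_append, Circuit.matrix_cons, Circuit.matrix_cons, Circuit.matrix_nil,
    Matrix.one_mul, ← Matrix.mulVec_mulVec, ← Matrix.mulVec_mulVec, Gate.cnot_mulVec, hC,
    Gate.cnot_mulVec]
  congr 2
  exact xor_update_involutive h y

/-- The gate `T`'s phase `e^{iπ/4}`. -/
noncomputable def eighthRoot : Circle := Circle.exp (Real.pi / 4)

theorem eighthRoot_pow_four : (eighthRoot : ℂ) ^ 4 = -1 := by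
  rw [eighthRoot, Circle.coe_exp, ← Complex.exp_nat_mul, ← Complex.exp_pi_mul_I]
  congr 1
  push_cast
  ring

/-- Controlled-controlled-`Z` from the phase polynomial `a + b + c - (a ⊕ b) - (a ⊕ c) - (b ⊕ c) +
(a ⊕ b ⊕ c) = 4abc`. -/
noncomputable def cczCircuit (a b c : W) (hab : a ≠ b) (hac : a ≠ c) (hbc : b ≠ c) : Circuit W :=
  ((([Gate.single a (phaseGate eighthRoot)] ++ [Gate.single b (phaseGate eighthRoot)]) ++
    ([Gate.single c (phaseGate eighthRoot)] ++
      (Gate.cnot a b hab :: [Gate.single b (phaseGate eighthRoot⁻¹)] ++ [Gate.cnot a b hab]))) ++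
  ((Gate.cnot a c hac :: [Gate.single c (phaseGate eighthRoot⁻¹)] ++ [Gate.cnot a c hac]) ++
    (Gate.cnot b c hbc :: [Gate.single c (phaseGate eighthRoot⁻¹)] ++ [Gate.cnot b c hbc]))) ++
  (Gate.cnot a c hac ::
    (Gate.cnot b c hbc :: [Gate.single c (phaseGate eighthRoot)] ++ [Gate.cnot b c hbc]) ++
    [Gate.cnot a c hac])

theorem cczCircuit_actsDiagonally (a b c : W) (hab : a ≠ b) (hac : a ≠ c) (hbc : b ≠ c) :
    (cczCircuit a b c hab hac hbc).ActsDiagonally fun y => if y a && y b && y c then -1 else 1 := by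
  have key := (((actsDiagonally_phase a eighthRoot).append (actsDiagonally_phase b eighthRoot)).append
    ((actsDiagonally_phase c eighthRoot).append
      ((actsDiagonally_phase b eighthRoot⁻¹).conj_cnot hab))).append
    (((actsDiagonally_phase c eighthRoot⁻¹).conj_cnot hac).append
      ((actsDiagonally_phase c eighthRoot⁻¹).conj_cnot hbc)) |>.append
    (((actsDiagonally_phase c eighthRoot).conj_cnot hbc).conj_cnot hac)
  have h0 : (eighthRoot : ℂ) ≠ 0 := Circle.coe_ne_zero _
  have h4 := eighthRoot_pow_four
  intro ψ y
  refine (key ψ y).trans ?_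
  congr 1
  -- The exponents of the eighth root cancel unless all three bits are set; then the exponent is
  -- four and the phase is `-1`.
  cases ha : y a <;> cases hb : y b <;> cases hc : y c <;>
    simp [ha, hb, hc, hbc, Circle.coe_inv] <;> field_simp
  linear_combination h4

/-- The Toffoli gate on two controls over `B₂`. -/
noncomputable def ccxCircuit (a b c : W) (hab : a ≠ b) (hac : a ≠ c) (hbc : b ≠ c) : Circuit W :=
  Gate.single c hadamardGate :: cczCircuit a b c hab hac hbc ++ [Gate.single c hadamardGate]

/-- Conjugation by Hadamard on `c` turns the controlled `Z` into a controlled `X`. -/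
theorem ccxCircuit_matrix (a b c : W) (hab : a ≠ b) (hac : a ≠ c) (hbc : b ≠ c) :
    Circuit.matrix (ccxCircuit a b c hab hac hbc) =
      basisMap fun x => Function.update x c (xor (x c) (x a && x b)) := by
  refine mulVec_injective_ext fun ψ y => ?_
  have h : (((√2 : ℝ) : ℂ)⁻¹) * (((√2 : ℝ) : ℂ)⁻¹) = 1 / 2 := by
    rw [← mul_inv, ← Complex.ofReal_mul, Real.mul_self_sqrt (by norm_num)]; norm_num
  rw [ccxCircuit, Circuit.matrix_append, Circuit.matrix_cons, Circuit.matrix_cons,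
    Circuit.matrix_nil, Matrix.one_mul, ← Matrix.mulVec_mulVec, ← Matrix.mulVec_mulVec,
    Gate.single_mulVec, basisMap_mulVec_of_involutive]
  · simp only [cczCircuit_actsDiagonally a b c hab hac hbc _ _, Gate.single_mulVec]
    have hy : Function.update y c (y c) = y := by simp
    cases ha : y a <;> cases hb : y b <;> cases hc : y c <;> rw [hc] at hy <;>
      simp [hadamardGate, ha, hb, hac, hbc, hy] <;>
      first
        | linear_combination (2 * ψ y) * h
        | linear_combination (2 * ψ (Function.update y c true)) * h
        | linear_combination (2 * ψ (Function.update y c false)) * h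
  · intro x
    ext v
    by_cases hv : v = c
    · subst hv; simp [hac, hbc]
    · simp [hv]

end Operators

/-! ### Classical reversible gates and their translation to `B₂`. -/

/-- Classical reversible gates. -/
inductive BitGate (L : Type) where
  | not (t : L) : BitGate L
  | cnot (c t : L) : BitGate L
  | ccnot (a b t : L) : BitGate L

namespace BitGate

/-- Relabelling of the wires. -/
def map {L M : Type} (f : L → M) : BitGate L → BitGate M
  | not t => not (f t)
  | cnot c t => cnot (f c) (f t)
  | ccnot a b t => ccnot (f a) (f b) (f t)

variable {L : Type} [DecidableEq L]

/-- The wires a gate acts on. -/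
def wires : BitGate L → Finset L
  | not t => {t}
  | cnot c t => {c, t}
  | ccnot a b t => {a, b, t}

/-- The action on assignments of bits; gates with coinciding wires do nothing. -/
def eval : BitGate L → (L → Bool) → L → Bool
  | not t, s => Function.update s t (!s t)
  | cnot c t, s => if c ≠ t then Function.update s t (xor (s t) (s c)) else s
  | ccnot a b t, s =>
    if a ≠ b ∧ a ≠ t ∧ b ≠ t then Function.update s t (xor (s t) (s a && s b)) else s

theorem eval_involutive (g : BitGate L) : Function.Involutive g.eval := by
  intro s
  ext v
  cases g with
  | not t => simp [eval]
  | cnot c t =>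
    by_cases h : c = t
    · simp [eval, h]
    · by_cases hv : v = t
      · subst hv; simp [eval, h]
      · simp [eval, h, hv]
  | ccnot a b t =>
    by_cases h : a ≠ b ∧ a ≠ t ∧ b ≠ t
    · by_cases hv : v = t
      · subst hv; simp [eval, h]
      · simp [eval, h, hv]
    · simp only [eval, h, if_false]

theorem eval_of_notMem (g : BitGate L) (s : L → Bool) {w : L} (h : w ∉ g.wires) :
    g.eval s w = s w := by
  cases g with
  | not t => simp_all [eval, wires]
  | cnot c t =>
    simp only [wires, Finset.mem_insert, Finset.mem_singleton, not_or] at h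
    simp only [eval]
    split_ifs <;> simp [h]
  | ccnot a b t =>
    simp only [wires, Finset.mem_insert, Finset.mem_singleton, not_or] at h
    simp only [eval]
    split_ifs <;> simp [h]

theorem eval_update (g : BitGate L) (s : L → Bool) {w : L} (h : w ∉ g.wires) (b : Bool) :
    g.eval (Function.update s w b) = Function.update (g.eval s) w b := by
  cases g with
  | not t =>
    simp only [wires, Finset.mem_singleton] at h
    simp only [eval]
    rw [Function.update_of_ne (Ne.symm h), Function.update_comm h]
  | cnot c t =>
    simp only [wires, Finset.mem_insert, Finset.mem_singleton, not_or] at h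
    simp only [eval]
    split_ifs
    · rw [Function.update_of_ne (Ne.symm h.1), Function.update_of_ne (Ne.symm h.2),
        Function.update_comm h.2]
    · rfl
  | ccnot a b t =>
    simp only [wires, Finset.mem_insert, Finset.mem_singleton, not_or] at h
    simp only [eval]
    split_ifs
    · rw [Function.update_of_ne (Ne.symm h.1), Function.update_of_ne (Ne.symm h.2.1),
        Function.update_of_ne (Ne.symm h.2.2), Function.update_comm h.2.2]
    · rfl

/-- The circuit over `B₂` for a classical gate. -/
noncomputable def compile : BitGate L → Circuit L
  | not t => [Gate.single t notGate]
  | cnot c t => if h : c ≠ t then [Gate.cnot c t h] else []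
  | ccnot a b t =>
    if h : a ≠ b ∧ a ≠ t ∧ b ≠ t then ccxCircuit a b t h.1 h.2.1 h.2.2 else []

theorem compile_matrix [Fintype L] (g : BitGate L) :
    Circuit.matrix g.compile = basisMap g.eval := by
  cases g with
  | not t =>
    rw [compile, Circuit.matrix_cons, Circuit.matrix_nil, Matrix.one_mul, notGate_matrix]
    rfl
  | cnot c t =>
    simp only [compile]
    split_ifs with h
    · rw [Circuit.matrix_cons, Circuit.matrix_nil, Matrix.one_mul, Gate.matrix]
      congr 1
      ext s
      simp [eval, h]
    · rw [Circuit.matrix_nil, ← basisMap_id]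
      congr 1
      ext s
      simp only [eval, if_neg h, id]
  | ccnot a b t =>
    simp only [compile]
    split_ifs with h
    · rw [ccxCircuit_matrix]
      congr 1
      ext s
      simp [eval, h]
    · rw [Circuit.matrix_nil, ← basisMap_id]
      congr 1
      ext s
      simp only [eval, if_neg h, id]

theorem compile_length_le (g : BitGate L) : g.compile.length ≤ 19 := by
  cases g with
  | not t => simp [compile]
  | cnot c t => simp only [compile]; split_ifs <;> simp
  | ccnot a b t => simp only [compile]; split_ifs <;> simp [ccxCircuit, cczCircuit]

theorem wires_subset_of_mem_compile (g : BitGate L) : ∀ e ∈ g.compile, e.wires ⊆ g.wires := by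
  intro e he w hw
  cases g with
  | not t => simp_all [compile, wires, Gate.wires]
  | cnot c t =>
    simp only [compile] at he
    split_ifs at he
    · simp_all [wires, Gate.wires]
    · simp at he
  | ccnot a b t =>
    simp only [compile] at he
    split_ifs at he
    · simp only [ccxCircuit, cczCircuit, List.cons_append, List.nil_append, List.mem_cons, List.not_mem_nil, or_false] at he
      simp only [wires, Finset.mem_insert, Finset.mem_singleton]
      rcases he with rfl | rfl | rfl | rfl | rfl | rfl | rfl | rfl | rfl | rfl | rfl | rfl | rfl |
        rfl | rfl | rfl | rfl | rfl | rfl <;>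
      · simp only [Gate.wires, Finset.mem_insert, Finset.mem_singleton] at hw
        tauto
    · simp at he

end BitGate

/-! ### Lists of classical gates: action, translation, and greedy timing. -/

section Run

variable {L : Type} [DecidableEq L]

/-- The action of a list of classical gates, applied in order. -/
def run (C : List (BitGate L)) (s : L → Bool) : L → Bool :=
  C.foldl (fun s g => g.eval s) s

@[simp] theorem run_nil (s : L → Bool) : run [] s = s := rfl

@[simp] theorem run_cons (g : BitGate L) (C : List (BitGate L)) (s : L → Bool) :
    run (g :: C) s = run C (g.eval s) := rfl

theorem run_append (C D : List (BitGate L)) (s : L → Bool) :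
    run (C ++ D) s = run D (run C s) := List.foldl_append ..

theorem run_reverse_run (C : List (BitGate L)) (s : L → Bool) : run C.reverse (run C s) = s := by
  induction C generalizing s with
  | nil => rfl
  | cons g C ih => rw [run_cons, List.reverse_cons, run_append, ih, run_cons, run_nil,
      g.eval_involutive]

theorem run_of_notMem (C : List (BitGate L)) (s : L → Bool) {w : L}
    (h : ∀ g ∈ C, w ∉ g.wires) : run C s w = s w := by
  induction C generalizing s with
  | nil => rfl
  | cons g C ih =>
    rw [run_cons, ih _ fun e he => h e (List.mem_cons_of_mem _ he),
      g.eval_of_notMem s (h g List.mem_cons_self)]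

/-- An untouched wire is neither read nor written, so overwriting it commutes with the circuit. This
lets the uncomputation pass the change of the target. -/
theorem run_update (C : List (BitGate L)) (s : L → Bool) {w : L}
    (h : ∀ g ∈ C, w ∉ g.wires) (b : Bool) :
    run C (Function.update s w b) = Function.update (run C s) w b := by
  induction C generalizing s with
  | nil => rfl
  | cons g C ih =>
    rw [run_cons, g.eval_update s (h g List.mem_cons_self),
      ih _ fun e he => h e (List.mem_cons_of_mem _ he), run_cons]

/-- The circuit over `B₂` for a list of classical gates. -/
noncomputable def compile (C : List (BitGate L)) : Circuit L := C.flatMap BitGate.compile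

theorem compile_matrix [Fintype L] (C : List (BitGate L)) :
    Circuit.matrix (compile C) = basisMap (run C) := by
  induction C with
  | nil => exact Circuit.matrix_nil.trans basisMap_id.symm
  | cons g C ih =>
    rw [compile, List.flatMap_cons, Circuit.matrix_append, g.compile_matrix]
    change Circuit.matrix (compile C) * _ = _
    rw [ih, basisMap_mul]
    rfl

theorem compile_length_le (C : List (BitGate L)) : (compile C).length ≤ 19 * C.length := by
  induction C with
  | nil => simp [compile]
  | cons g C ih =>
    have := g.compile_length_le
    simp only [compile, List.flatMap_cons, List.length_append, List.length_cons] at *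
    omega

/-- Greedy scheduling of an operation on the wires `F`, as in `Gate.schedule`. -/
def scheduleOn (τ : L → ℕ) (F : Finset L) : L → ℕ := fun w => if w ∈ F then F.sup τ + 1 else τ w

/-- The last time steps in which the wires are used, when each classical gate takes one step. -/
def finish (τ : L → ℕ) (C : List (BitGate L)) : L → ℕ :=
  C.foldl (fun τ g => scheduleOn τ g.wires) τ

@[simp] theorem finish_nil (τ : L → ℕ) : finish τ [] = τ := rfl

@[simp] theorem finish_cons (τ : L → ℕ) (g : BitGate L) (C : List (BitGate L)) :
    finish τ (g :: C) = finish (scheduleOn τ g.wires) C := rfl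

theorem finish_append (τ : L → ℕ) (C D : List (BitGate L)) :
    finish τ (C ++ D) = finish (finish τ C) D := List.foldl_append ..

theorem finish_le_add_length {τ : L → ℕ} {T : ℕ} (h : ∀ w, τ w ≤ T) (C : List (BitGate L)) (w : L) :
    finish τ C w ≤ T + C.length := by
  induction C generalizing τ T with
  | nil => exact h w
  | cons g C ih =>
    rw [finish_cons, List.length_cons, Nat.add_comm C.length, ← Nat.add_assoc]
    refine ih fun v => ?_
    unfold scheduleOn
    split_ifs
    · exact Nat.succ_le_succ (Finset.sup_le fun u _ => h u)
    · exact (h v).trans (Nat.le_succ T)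

/-- Time reversal: read backwards from the deadline `D`, a schedule for `C` is a schedule for the
reversed list, and greedy execution is no later. Hence uncomputing takes no longer than computing.
-/
theorem finish_reverse_add_le {σ τ : L → ℕ} {D : ℕ} (C : List (BitGate L))
    (h : ∀ w, σ w + finish τ C w ≤ D) (w : L) : finish σ C.reverse w + τ w ≤ D := by
  induction C generalizing τ w with
  | nil => exact h w
  | cons g C ih =>
    rw [List.reverse_cons, finish_append, finish_cons, finish_nil]
    have ih' : ∀ w, finish σ C.reverse w + scheduleOn τ g.wires w ≤ D := ih h
    unfold scheduleOn
    split_ifs with hw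
    · obtain ⟨v, hv, hsup⟩ := Finset.exists_mem_eq_sup g.wires ⟨w, hw⟩ (finish σ C.reverse)
      rw [hsup]
      have h1 := ih' v
      rw [scheduleOn, if_pos hv] at h1
      have h2 : τ w ≤ g.wires.sup τ := Finset.le_sup hw
      omega
    · have h1 := ih' w
      rwa [scheduleOn, if_neg hw] at h1

theorem foldl_schedule_of_notMem (B : Circuit L) {F : Finset L} (hB : ∀ e ∈ B, e.wires ⊆ F)
    (σ : L → ℕ) {w : L} (hw : w ∉ F) : B.foldl Gate.schedule σ w = σ w := by
  induction B generalizing σ with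
  | nil => rfl
  | cons e B ih =>
    rw [List.foldl_cons, ih fun e he => hB e (List.mem_cons_of_mem _ he), Gate.schedule,
      if_neg fun h => hw (hB e List.mem_cons_self h)]

theorem foldl_schedule_le (B : Circuit L) {F : Finset L} (hB : ∀ e ∈ B, e.wires ⊆ F)
    {σ : L → ℕ} {T : ℕ} (hσ : ∀ w ∈ F, σ w ≤ T) : ∀ w ∈ F, B.foldl Gate.schedule σ w ≤
      T + B.length := by
  induction B generalizing σ T with
  | nil => exact hσ
  | cons e B ih =>
    rw [List.foldl_cons, List.length_cons, Nat.add_comm B.length, ← Nat.add_assoc]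
    refine ih (fun e he => hB e (List.mem_cons_of_mem _ he)) fun w hw => ?_
    unfold Gate.schedule
    split_ifs
    · exact Nat.succ_le_succ (Finset.sup_le fun u hu => hσ u (hB e List.mem_cons_self hu))
    · exact (hσ w hw).trans (Nat.le_succ T)

/-- A classical gate becomes at most 19 gates on the same wires, so stretching every classical time
step by 19 leaves room to execute them even serially. -/
theorem foldl_schedule_compile_le {σ τ : L → ℕ} (h : ∀ w, σ w ≤ 19 * τ w) (C : List (BitGate L))
    (w : L) : (compile C).foldl Gate.schedule σ w ≤ 19 * finish τ C w := by
  induction C generalizing σ τ with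
  | nil => exact h w
  | cons g C ih =>
    rw [compile, List.flatMap_cons, List.foldl_append, finish_cons]
    refine ih fun v => ?_
    unfold scheduleOn
    split_ifs with hv
    · have := foldl_schedule_le g.compile g.wires_subset_of_mem_compile (σ := σ)
        (T := 19 * g.wires.sup τ)
        (fun u hu => (h u).trans (Nat.mul_le_mul_left _ (Finset.le_sup hu))) v hv
      have := g.compile_length_le
      omega
    · rw [foldl_schedule_of_notMem _ g.wires_subset_of_mem_compile _ hv]
      exact h v

theorem compile_depth_le [Fintype L] (C : List (BitGate L)) {T : ℕ}
    (h : ∀ w, finish (fun _ => 0) C w ≤ T) : Circuit.depth (compile C) ≤ 19 * T :=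
  Finset.sup_le fun w _ => (foldl_schedule_compile_le (τ := fun _ => 0) (by simp) C w).trans
    (Nat.mul_le_mul_left _ (h w))

end Run

/-! ### Transport of circuits along injective renamings of wires. -/

section Relabel

variable {L M : Type} [DecidableEq L] [DecidableEq M] {ρ : L → M}

theorem BitGate.wires_map (g : BitGate L) : (g.map ρ).wires = g.wires.image ρ := by
  cases g <;> simp [map, wires, Finset.image_insert]

theorem BitGate.eval_map (hρ : Function.Injective ρ) (g : BitGate L) (s : M → Bool) :
    (g.map ρ).eval s ∘ ρ = g.eval (s ∘ ρ) := by
  ext w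
  cases g with
  | not t => simp [map, eval, Function.update_apply, hρ.eq_iff]
  | cnot c t =>
    by_cases h : c = t <;> simp [map, eval, Function.update_apply, hρ.eq_iff, h]
  | ccnot a b t =>
    by_cases h : a ≠ b ∧ a ≠ t ∧ b ≠ t
    · simp [map, eval, Function.update_apply, hρ.eq_iff, h]
    · have h' : ¬ (ρ a ≠ ρ b ∧ ρ a ≠ ρ t ∧ ρ b ≠ ρ t) := by simpa only [hρ.ne_iff] using h
      simp only [map, eval, if_neg h, if_neg h']

theorem run_map (hρ : Function.Injective ρ) (C : List (BitGate L)) (s : M → Bool) :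
    run (C.map (BitGate.map ρ)) s ∘ ρ = run C (s ∘ ρ) := by
  induction C generalizing s with
  | nil => rfl
  | cons g C ih => rw [List.map_cons, run_cons, ih, g.eval_map hρ, run_cons]

theorem finish_map (hρ : Function.Injective ρ) (C : List (BitGate L)) (τ : M → ℕ) :
    finish τ (C.map (BitGate.map ρ)) ∘ ρ = finish (τ ∘ ρ) C := by
  induction C generalizing τ with
  | nil => rfl
  | cons g C ih =>
    rw [List.map_cons, finish_cons, ih, finish_cons]
    congr 1
    ext w
    simp [scheduleOn, BitGate.wires_map, Finset.sup_image, hρ.eq_iff]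

end Relabel

/-- Allows the circuit to be designed on an infinite set of symbolic labels and then pulled back to
the actual register. -/
theorem exists_map_eq {L M : Type} [DecidableEq M] {ρ : L → M} (C : List (BitGate M)) (h : ∀ g ∈ C, ∀ w ∈ g.wires, w ∈ Set.range ρ) :
    ∃ D : List (BitGate L), D.map (BitGate.map ρ) = C := by
  induction C with
  | nil => exact ⟨[], rfl⟩
  | cons g C ih =>
    obtain ⟨D, rfl⟩ := ih fun e he => h e (List.mem_cons_of_mem _ he)
    suffices ∃ e : BitGate L, e.map ρ = g by
      obtain ⟨e, rfl⟩ := this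
      exact ⟨e :: D, rfl⟩
    have hg := h g List.mem_cons_self
    cases g with
    | not t =>
      obtain ⟨t, rfl⟩ := hg t (by simp [BitGate.wires])
      exact ⟨.not t, rfl⟩
    | cnot c t =>
      obtain ⟨t, rfl⟩ := hg t (by simp [BitGate.wires])
      obtain ⟨c, rfl⟩ := hg c (by simp [BitGate.wires])
      exact ⟨.cnot c t, rfl⟩
    | ccnot a b t =>
      obtain ⟨t, rfl⟩ := hg t (by simp [BitGate.wires])
      obtain ⟨a, rfl⟩ := hg a (by simp [BitGate.wires])
      obtain ⟨b, rfl⟩ := hg b (by simp [BitGate.wires])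
      exact ⟨.ccnot a b t, rfl⟩

/-! ### Timing of untouched wires and of single operations. -/

section Schedule

variable {L : Type} [DecidableEq L]

theorem scheduleOn_le {τ : L → ℕ} {F : Finset L} {T : ℕ} (h : ∀ u ∈ F, τ u ≤ T) {w : L}
    (hw : w ∈ F) : scheduleOn τ F w ≤ T + 1 := by
  rw [scheduleOn, if_pos hw]
  exact Nat.succ_le_succ (Finset.sup_le h)

theorem scheduleOn_of_notMem {τ : L → ℕ} {F : Finset L} {w : L} (hw : w ∉ F) :
    scheduleOn τ F w = τ w := if_neg hw

theorem finish_of_notMem (τ : L → ℕ) (C : List (BitGate L)) {w : L}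
    (h : ∀ g ∈ C, w ∉ g.wires) : finish τ C w = τ w := by
  induction C generalizing τ with
  | nil => rfl
  | cons g C ih =>
    rw [finish_cons, ih _ fun e he => h e (List.mem_cons_of_mem _ he),
      scheduleOn_of_notMem (h g List.mem_cons_self)]

end Schedule

/-! ### Conjunction trees in heap order: correctness and timing. -/

section Collect

variable {L : Type} [DecidableEq L]

/-- Store the conjunction of `u` and `v` in the cleared bit `w`, then clear `u` and `v` for the case
that the conjunction holds. -/
def collect (u v w : L) : List (BitGate L) := [.ccnot u v w, .not u, .not v]

theorem run_collect {u v w : L} (huv : u ≠ v) (huw : u ≠ w) (hvw : v ≠ w) (s : L → Bool) (l : L) :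
    run (collect u v w) s l =
      if l = w then xor (s w) (s u && s v) else if l = u ∨ l = v then !s l else s l := by
  by_cases h1 : l = w
  · subst h1
    simp [collect, BitGate.eval, huv, huw, hvw, huw.symm, hvw.symm]
  by_cases h2 : l = u
  · subst h2
    simp [collect, BitGate.eval, huv, huw, hvw]
  by_cases h3 : l = v
  · subst h3
    simp [collect, BitGate.eval, huv, huv.symm, huw, hvw]
  simp [collect, BitGate.eval, huv, huw, hvw, h1, h2, h3]

theorem finish_collect_le {u v w : L} (huv : u ≠ v) (huw : u ≠ w) (hvw : v ≠ w) {τ : L → ℕ} {T : ℕ}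
    (hu : τ u ≤ T) (hv : τ v ≤ T) (hw : τ w ≤ T) :
    finish τ (collect u v w) w ≤ T + 1 ∧ finish τ (collect u v w) u ≤ T + 2 ∧
      finish τ (collect u v w) v ≤ T + 2 := by
  have h : ∀ l ∈ ({u, v, w} : Finset L), scheduleOn τ {u, v, w} l ≤ T + 1 := fun l hl =>
    scheduleOn_le (by simp [hu, hv, hw]) hl
  have h1 := h u (by simp)
  have h2 := h v (by simp)
  have h3 := h w (by simp)
  simp only [collect, finish_cons, finish_nil, BitGate.wires]
  refine ⟨?_, ?_, ?_⟩
  · rwa [scheduleOn_of_notMem (by simpa using hvw.symm),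
      scheduleOn_of_notMem (by simpa using huw.symm)]
  · rw [scheduleOn_of_notMem (by simpa using huv)]
    exact scheduleOn_le (by simpa using h1) (by simp)
  · refine scheduleOn_le (T := T + 1) ?_ (by simp)
    simp only [Finset.mem_singleton, forall_eq]
    rwa [scheduleOn_of_notMem (by simpa using huv.symm)]

theorem mem_wires_of_mem_collect {u v w : L} {g : BitGate L} (hg : g ∈ collect u v w) {l : L}
    (hl : l ∈ g.wires) : l = u ∨ l = v ∨ l = w := by
  simp only [collect, List.mem_cons, List.not_mem_nil, or_false] at hg
  rcases hg with rfl | rfl | rfl <;> simp [BitGate.wires] at hl <;> tauto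

/-- Evaluation of the conjunction tree whose internal nodes `1, …, j` have children `2 i` and
`2 i + 1`. -/
def heapCircuit (h : ℕ → L) : ℕ → List (BitGate L)
  | 0 => []
  | j + 1 => collect (h (2 * (j + 1))) (h (2 * (j + 1) + 1)) (h (j + 1)) ++ heapCircuit h j

theorem length_heapCircuit {L : Type} (h : ℕ → L) (j : ℕ) : (heapCircuit h j).length = 3 * j := by
  induction j with
  | zero => rfl
  | succ j ih => simp [heapCircuit, collect, ih]; ring

theorem mem_wires_of_mem_heapCircuit {h : ℕ → L} {j : ℕ} {g : BitGate L} (hg : g ∈ heapCircuit h j)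
    {l : L} (hl : l ∈ g.wires) : ∃ i, 1 ≤ i ∧ i ≤ 2 * j + 1 ∧ l = h i := by
  induction j with
  | zero => simp [heapCircuit] at hg
  | succ j ih =>
    rw [heapCircuit, List.mem_append] at hg
    rcases hg with hg | hg
    · rcases mem_wires_of_mem_collect hg hl with h | h | h
      · exact ⟨_, by omega, by omega, h⟩
      · exact ⟨_, by omega, by omega, h⟩
      · exact ⟨_, by omega, by omega, h⟩
    · obtain ⟨i, h1, h2, h3⟩ := ih hg
      exact ⟨i, h1, by omega, h3⟩

theorem run_heapCircuit_of_ne {h : ℕ → L} {j : ℕ} (s : L → Bool) {l : L}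
    (hl : ∀ i, 1 ≤ i → i ≤ 2 * j + 1 → l ≠ h i) : run (heapCircuit h j) s l = s l := by
  refine run_of_notMem _ _ fun g hg hmem => ?_
  obtain ⟨i, h1, h2, h3⟩ := mem_wires_of_mem_heapCircuit hg hmem
  exact hl i h1 h2 h3

/-- Evaluating node `j + 1` first makes it a leaf of the smaller tree with internal nodes `1, …, j`,
which drives the induction. The second claim is what makes the bits reusable: when all leaves hold,
everything except the root ends up cleared. -/
theorem run_heapCircuit {h : ℕ → L} (hinj : Function.Injective h) (j : ℕ) {s : L → Bool}
    (hs : ∀ i, 1 ≤ i → i ≤ j → s (h i) = false) :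
    (run (heapCircuit h j) s (h 1) = true ↔ ∀ i, j < i → i ≤ 2 * j + 1 → s (h i) = true) ∧
    ((∀ i, j < i → i ≤ 2 * j + 1 → s (h i) = true) →
      ∀ i, 2 ≤ i → i ≤ 2 * j + 1 → run (heapCircuit h j) s (h i) = false) := by
  induction j generalizing s with
  | zero =>
    refine ⟨⟨fun H i h1 h2 => ?_, fun H => H 1 (by omega) (by omega)⟩, fun _ i h1 h2 => by omega⟩
    obtain rfl : i = 1 := by omega
    exact H
  | succ j ih =>
    rw [heapCircuit, run_append]
    set s' := run (collect (h (2 * (j + 1))) (h (2 * (j + 1) + 1)) (h (j + 1))) s with hs'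
    have hval : ∀ i, s' (h i) = if i = j + 1 then
        (s (h (2 * (j + 1))) && s (h (2 * (j + 1) + 1)))
        else if i = 2 * (j + 1) ∨ i = 2 * (j + 1) + 1 then !s (h i) else s (h i) := by
      intro i
      rw [hs', run_collect (hinj.ne (by omega)) (hinj.ne (by omega)) (hinj.ne (by omega)),
        hs (j + 1) (by omega) le_rfl, Bool.false_xor]
      simp only [hinj.eq_iff]
    have hz : ∀ i, 1 ≤ i → i ≤ j → s' (h i) = false := fun i h1 h2 => by
      rw [hval, if_neg (by omega), if_neg (by omega)]
      exact hs i h1 (by omega)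
    obtain ⟨ih1, ih2⟩ := ih hz
    -- The leaves of the smaller tree are the old ones with the two children of `j + 1` replaced by
    -- `j + 1` itself.
    have hiff : (∀ i, j < i → i ≤ 2 * j + 1 → s' (h i) = true) ↔
        ∀ i, j + 1 < i → i ≤ 2 * (j + 1) + 1 → s (h i) = true := by
      constructor
      · intro H i h1 h2
        have h3 := H (j + 1) (by omega) (by omega)
        rw [hval, if_pos rfl, Bool.and_eq_true] at h3
        rcases (by omega : i = 2 * (j + 1) ∨ i = 2 * (j + 1) + 1 ∨ i ≤ 2 * j + 1) with h4 | h4 | h4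
        · rw [h4]; exact h3.1
        · rw [h4]; exact h3.2
        · have := H i (by omega) h4
          rwa [hval, if_neg (by omega), if_neg (by omega)] at this
      · intro H i h1 h2
        rw [hval]
        split_ifs with h3 h4
        · rw [H _ (by omega) (by omega), H _ (by omega) (by omega)]; rfl
        · omega
        · exact H i (by omega) (by omega)
    refine ⟨ih1.trans hiff, fun H i h1 h2 => ?_⟩
    by_cases h3 : i ≤ 2 * j + 1
    · exact ih2 (hiff.2 H) i h1 h3
    · rw [run_heapCircuit_of_ne _ fun i' _ _ => hinj.ne (by omega), hval, if_neg (by omega),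
        if_pos (by omega), H i (by omega) h2]
      rfl

/-- Node `i` has level `Nat.log 2 i`, and its availability is measured against a time that decreases
by two per level. Entering and leaving bounds have the same form, with `T` raised by 4, so
successive trees can be pipelined. -/
theorem finish_heapCircuit_le {h : ℕ → L} (hinj : Function.Injective h) (T j : ℕ) {τ : L → ℕ}
    (hτ : ∀ i, 1 ≤ i → i ≤ j → τ (h i) + 2 * Nat.log 2 i ≤ T)
    (hτ' : ∀ i, j < i → i ≤ 2 * j + 1 → τ (h i) + 2 * Nat.log 2 i ≤ T + 1) :
    finish τ (heapCircuit h j) (h 1) ≤ T + 1 ∧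
    ∀ i, 2 ≤ i → i ≤ 2 * j + 1 → finish τ (heapCircuit h j) (h i) + 2 * Nat.log 2 i ≤ T + 4 := by
  induction j generalizing τ with
  | zero => exact ⟨by simpa [heapCircuit] using hτ' 1, fun i h1 h2 => by omega⟩
  | succ j ih =>
    rw [heapCircuit, finish_append]
    have hl0 : Nat.log 2 (2 * (j + 1)) = Nat.log 2 (j + 1) + 1 := by
      rw [mul_comm, Nat.log_mul_base (by norm_num) (by omega)]
    have hl1 : Nat.log 2 (2 * (j + 1) + 1) = Nat.log 2 (j + 1) + 1 := by
      rw [Nat.log_of_one_lt_of_le (by norm_num) (by omega)]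
      congr 2
      omega
    have hp := hτ (j + 1) (by omega) le_rfl
    have hc0 := hτ' (2 * (j + 1)) (by omega) (by omega)
    have hc1 := hτ' (2 * (j + 1) + 1) (by omega) (by omega)
    -- The subtraction in the starting time does not truncate, by `hp`. The children are released
    -- two steps later and lie one level deeper, whence `2 + 2 = 4`.
    obtain ⟨f1, f2, f3⟩ := finish_collect_le (u := h (2 * (j + 1))) (v := h (2 * (j + 1) + 1))
      (w := h (j + 1)) (hinj.ne (by omega)) (hinj.ne (by omega)) (hinj.ne (by omega)) (τ := τ)
      (T := T - 2 * Nat.log 2 (j + 1)) (by omega) (by omega) (by omega)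
    have hother : ∀ i, i ≠ j + 1 → i ≠ 2 * (j + 1) → i ≠ 2 * (j + 1) + 1 →
        finish τ (collect (h (2 * (j + 1))) (h (2 * (j + 1) + 1)) (h (j + 1))) (h i) = τ (h i) := by
      intro i h1 h2 h3
      refine finish_of_notMem _ _ fun g hg hmem => ?_
      have := mem_wires_of_mem_collect hg hmem
      simp only [hinj.eq_iff] at this
      tauto
    obtain ⟨ih1, ih2⟩ := ih
      (τ := finish τ (collect (h (2 * (j + 1))) (h (2 * (j + 1) + 1)) (h (j + 1))))
      (fun i h1 h2 => by
        rw [hother i (by omega) (by omega) (by omega)]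
        exact hτ i h1 (by omega))
      (fun i h1 h2 => by
        by_cases h3 : i = j + 1
        · rw [h3]; omega
        · rw [hother i h3 (by omega) (by omega)]
          exact hτ' i (by omega) (by omega))
    refine ⟨ih1, fun i h1 h2 => ?_⟩
    by_cases h3 : i ≤ 2 * j + 1
    · exact ih2 i h1 h3
    · rw [finish_of_notMem _ (heapCircuit h j) fun g hg hmem => by
        obtain ⟨i', _, _, h5⟩ := mem_wires_of_mem_heapCircuit hg hmem
        have := hinj h5
        omega]
      rcases (by omega : i = 2 * (j + 1) ∨ i = 2 * (j + 1) + 1) with h4 | h4 <;> rw [h4] <;> omega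

end Collect

/-! ### Multi-controlled NOT with borrowed bits. -/

section Ladder

variable {L : Type} [DecidableEq L]

/-- Adds the conjunction of the bits `cs` to `t`, with an arbitrary change of the borrowed bits
`ds`. -/
def ladder : L → List L → List L → List (BitGate L)
  | t, [], _ => [.not t]
  | t, [c], _ => [.cnot c t]
  | _, _ :: _ :: _, [] => []
  | t, c :: c' :: cs, d :: ds => .ccnot c d t :: ladder d (c' :: cs) ds ++ [.ccnot c d t]

/-- Adds the conjunction of the bits `cs` to `t`, and restores the borrowed bits `ds`. -/
def multiControlledNot (t : L) : List L → List L → List (BitGate L)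
  | c :: c' :: cs, d :: ds =>
    (.ccnot c d t :: ladder d (c' :: cs) ds) ++ (.ccnot c d t :: ladder d (c' :: cs) ds)
  | cs, ds => ladder t cs ds

theorem reverse_ladder {L : Type} (t : L) (cs ds : List L) : (ladder t cs ds).reverse = ladder t cs ds := by
  induction ds generalizing t cs with
  | nil => rcases cs with _ | ⟨c, _ | ⟨c', cs⟩⟩ <;> rfl
  | cons d ds ih =>
    rcases cs with _ | ⟨c, _ | ⟨c', cs⟩⟩
    · rfl
    · rfl
    · simp [ladder, ih]

theorem length_ladder_le {L : Type} (t : L) (cs ds : List L) : (ladder t cs ds).length ≤ 2 * cs.length + 1 := by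
  induction ds generalizing t cs with
  | nil => rcases cs with _ | ⟨c, _ | ⟨c', cs⟩⟩ <;> simp [ladder]
  | cons d ds ih =>
    rcases cs with _ | ⟨c, _ | ⟨c', cs⟩⟩
    · simp [ladder]
    · simp [ladder]
    · have := ih d (c' :: cs)
      simp [ladder] at this ⊢
      omega

theorem length_multiControlledNot_le {L : Type} (t : L) (cs ds : List L) :
    (multiControlledNot t cs ds).length ≤ 4 * cs.length + 4 := by
  unfold multiControlledNot
  split
  · rename_i c c' cs d ds
    have := length_ladder_le d (c' :: cs) ds
    simp at this ⊢
    omega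
  · have := length_ladder_le t cs ds
    omega

theorem mem_wires_of_mem_ladder {t : L} {cs ds : List L} {g : BitGate L}
    (hg : g ∈ ladder t cs ds) {l : L} (hl : l ∈ g.wires) : l = t ∨ l ∈ cs ∨ l ∈ ds := by
  induction ds generalizing t cs with
  | nil =>
    rcases cs with _ | ⟨c, _ | ⟨c', cs⟩⟩ <;> simp [ladder] at hg <;> subst hg <;>
      simp [BitGate.wires] at hl <;> simp <;> tauto
  | cons d ds ih =>
    rcases cs with _ | ⟨c, _ | ⟨c', cs⟩⟩
    · simp [ladder] at hg; subst hg; simp [BitGate.wires] at hl; tauto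
    · simp [ladder] at hg; subst hg; simp [BitGate.wires] at hl; simp; tauto
    · simp only [ladder, List.cons_append, List.mem_cons, List.mem_append, List.not_mem_nil,
        or_false] at hg
      rcases hg with rfl | hg | rfl
      · simp [BitGate.wires] at hl; simp; tauto
      · have := ih hg
        simp at this ⊢
        tauto
      · simp [BitGate.wires] at hl; simp; tauto

theorem mem_wires_of_mem_multiControlledNot {t : L} {cs ds : List L} {g : BitGate L}
    (hg : g ∈ multiControlledNot t cs ds) {l : L} (hl : l ∈ g.wires) :
    l = t ∨ l ∈ cs ∨ l ∈ ds := by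
  unfold multiControlledNot at hg
  split at hg
  · simp only [List.cons_append, List.mem_cons, List.mem_append] at hg
    rcases hg with rfl | hg | rfl | hg
    · simp [BitGate.wires] at hl; simp; tauto
    · have := mem_wires_of_mem_ladder hg hl
      simp at this ⊢
      tauto
    · simp [BitGate.wires] at hl; simp; tauto
    · have := mem_wires_of_mem_ladder hg hl
      simp at this ⊢
      tauto
  · exact mem_wires_of_mem_ladder hg hl

theorem run_conj_ccnot {A : List (BitGate L)} {c d t : L} (hcd : c ≠ d) (hct : c ≠ t) (hdt : d ≠ t)
    (htA : ∀ g ∈ A, t ∉ g.wires) (s : L → Bool) :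
    run (.ccnot c d t :: A ++ [.ccnot c d t]) s = Function.update (run A s) t
      (xor (xor (s t) (s c && s d)) (run A s c && run A s d)) := by
  have he : ∀ s : L → Bool, (BitGate.ccnot c d t).eval s =
      Function.update s t (xor (s t) (s c && s d)) := fun s => if_pos ⟨hcd, hct, hdt⟩
  rw [run_append, run_cons, run_cons, run_nil, he s, run_update A s htA, he]
  simp [hct, hdt]

/-- Let `r` be the conjunction of the remaining controls. The inner ladder changes `d` to `d ⊕ r`,
so the two outer gates add `c d ⊕ c (d ⊕ r) = c r` to `t`, whatever the value of `d`. -/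
theorem run_ladder {t : L} {cs ds : List L} (hnd : (t :: (cs ++ ds)).Nodup)
    (hlen : cs.length ≤ ds.length + 1) (s : L → Bool) :
    run (ladder t cs ds) s t = xor (s t) (cs.all s) ∧
      ∀ l, l ≠ t → l ∉ ds → run (ladder t cs ds) s l = s l := by
  have base : ∀ (s : L → Bool) (t : L) (ds : List L), run (ladder t [] ds) s t = xor (s t) (([] : List L).all s) ∧
      ∀ l, l ≠ t → l ∉ ds → run (ladder t [] ds) s l = s l := by
    intro s t ds
    simp only [ladder, run_cons, run_nil, BitGate.eval]
    exact ⟨by simp, fun l h1 _ => by simp [h1]⟩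
  have base1 : ∀ (s : L → Bool) (t c : L) (ds : List L), c ≠ t →
      run (ladder t [c] ds) s t = xor (s t) ([c].all s) ∧
      ∀ l, l ≠ t → l ∉ ds → run (ladder t [c] ds) s l = s l := by
    intro s t c ds hc
    simp only [ladder, run_cons, run_nil, BitGate.eval, if_pos hc]
    exact ⟨by simp, fun l h1 _ => by simp [h1]⟩
  induction ds generalizing t cs s with
  | nil =>
    rcases cs with _ | ⟨c, _ | ⟨c', cs⟩⟩
    · exact base _ _ _
    · exact base1 _ _ c _ (by simp at hnd; tauto)
    · simp at hlen
  | cons d ds ih =>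
    rcases cs with _ | ⟨c, _ | ⟨c', cs⟩⟩
    · exact base _ _ _
    · exact base1 _ _ c _ (by simp at hnd; tauto)
    · have hnd' : (d :: ((c' :: cs) ++ ds)).Nodup := by
        simp only [List.cons_append, List.nodup_cons, List.mem_cons, List.mem_append,
          List.nodup_append] at hnd ⊢
        grind
      obtain ⟨ih1, ih2⟩ := ih hnd' (by simpa using hlen) s
      have hct : c ≠ t := by simp at hnd; tauto
      have hcd : c ≠ d := by simp at hnd; tauto
      have hdt : d ≠ t := by simp at hnd; tauto
      have hcds : c ∉ ds := by simp at hnd; tauto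
      have htA : ∀ g ∈ ladder d (c' :: cs) ds, t ∉ g.wires := fun g hg hmem => by
        have := mem_wires_of_mem_ladder hg hmem
        simp at hnd this
        tauto
      rw [ladder, run_conj_ccnot hcd hct hdt htA, ih1, ih2 c hcd hcds]
      refine ⟨?_, fun l h1 h2 => ?_⟩
      · rw [Function.update_self, List.all_cons (l := c' :: cs)]
        generalize (c' :: cs).all s = b
        cases s t <;> cases s c <;> cases s d <;> cases b <;> rfl
      · simp only [List.mem_cons, not_or] at h2
        rw [Function.update_of_ne h1, ih2 l h2.1 h2.2]

/-- A ladder is a palindrome of involutions, hence its own inverse. Repeating the inner ladder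
therefore restores all borrowed bits, while `t` keeps its new value. -/
theorem run_multiControlledNot {t : L} {cs ds : List L} (hnd : (t :: (cs ++ ds)).Nodup)
    (hlen : cs.length ≤ ds.length + 1) (s : L → Bool) :
    run (multiControlledNot t cs ds) s = Function.update s t (xor (s t) (cs.all s)) := by
  unfold multiControlledNot
  split
  · rename_i c c' cs d ds
    have hnd' : (d :: ((c' :: cs) ++ ds)).Nodup := by
      simp only [List.cons_append, List.nodup_cons, List.mem_cons, List.mem_append,
        List.nodup_append] at hnd ⊢
      grind
    obtain ⟨h1, h2⟩ := run_ladder hnd' (by simpa using hlen) s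
    have hct : c ≠ t := by simp at hnd; tauto
    have hcd : c ≠ d := by simp at hnd; tauto
    have hdt : d ≠ t := by simp at hnd; tauto
    have hcds : c ∉ ds := by simp at hnd; tauto
    have htA : ∀ g ∈ ladder d (c' :: cs) ds, t ∉ g.wires := fun g hg hmem => by
      have := mem_wires_of_mem_ladder hg hmem
      simp at hnd this
      tauto
    have hinv := run_reverse_run (ladder d (c' :: cs) ds) s
    rw [reverse_ladder] at hinv
    -- Regroup the four blocks as a conjugated inner ladder followed by a second inner ladder.
    rw [List.append_cons, run_append, run_conj_ccnot hcd hct hdt htA, run_update _ _ htA, hinv, h1,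
      h2 c hcd hcds, List.all_cons (l := c' :: cs)]
    congr 1
    generalize (c' :: cs).all s = b
    cases s t <;> cases s c <;> cases s d <;> cases b <;> rfl
  · rename_i hne
    rcases cs with _ | ⟨c, _ | ⟨c', cs⟩⟩
    · simp [ladder, BitGate.eval]
    · have hct : c ≠ t := by simp at hnd; tauto
      simp [ladder, BitGate.eval, hct]
    · rcases ds with _ | ⟨d, ds⟩
      · simp at hlen
      · exact (hne _ _ _ _ _ rfl rfl).elim

end Ladder

/-! ### The doubling stages. -/

/-- Names of the wires: `root 0` is the ancilla, `target` the target, all others are controls. -/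
inductive Label where
  | heap (i : ℕ) : Label
  | root (k : ℕ) : Label
  | leaf (i : ℕ) : Label
  | target : Label
  deriving DecidableEq

open Label

theorem Label.heap_injective : Function.Injective heap := fun _ _ h => by cases h; rfl

/-- The conjunction of the `2 ^ k` controls `heap i`, `2 ^ k ≤ i < 2 ^ (k + 1)`, and of
`root (k + 1)` is computed into `root k`, using the bits `heap i`, `i < 2 ^ k`, which are zero if
all earlier roots are one. -/
def stage (k : ℕ) : List (BitGate Label) :=
  heapCircuit heap (2 ^ k - 1) ++ collect (heap 1) (root (k + 1)) (root k)

/-- The first `K` stages. -/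
def stages : ℕ → List (BitGate Label)
  | 0 => []
  | K + 1 => stages K ++ stage K

theorem mem_wires_of_mem_stage {k : ℕ} {g : BitGate Label} (hg : g ∈ stage k) {l : Label}
    (hl : l ∈ g.wires) :
    (∃ i, 1 ≤ i ∧ i < 2 ^ (k + 1) ∧ l = heap i) ∨ l = root k ∨ l = root (k + 1) := by
  have hpos : 0 < 2 ^ k := by positivity
  have hpow : 2 ^ (k + 1) = 2 * 2 ^ k := by ring
  rw [stage, List.mem_append] at hg
  rcases hg with hg | hg
  · obtain ⟨i, h1, h2, h3⟩ := mem_wires_of_mem_heapCircuit hg hl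
    exact Or.inl ⟨i, h1, by omega, h3⟩
  · rcases mem_wires_of_mem_collect hg hl with h | h | h
    · exact Or.inl ⟨1, le_rfl, by omega, h⟩
    · exact Or.inr (Or.inr h)
    · exact Or.inr (Or.inl h)

theorem mem_wires_of_mem_stages {K : ℕ} {g : BitGate Label} (hg : g ∈ stages K) {l : Label}
    (hl : l ∈ g.wires) :
    (∃ i, 1 ≤ i ∧ i < 2 ^ K ∧ l = heap i) ∨ ∃ k ≤ K, l = root k := by
  induction K with
  | zero => simp [stages] at hg
  | succ K ih =>
    have hpow : 2 ^ (K + 1) = 2 * 2 ^ K := by ring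
    rw [stages, List.mem_append] at hg
    rcases hg with hg | hg
    · rcases ih hg with ⟨i, h1, h2, h3⟩ | ⟨k, h1, h2⟩
      · exact Or.inl ⟨i, h1, by omega, h3⟩
      · exact Or.inr ⟨k, by omega, h2⟩
    · rcases mem_wires_of_mem_stage hg hl with h | h | h
      · exact Or.inl h
      · exact Or.inr ⟨_, by omega, h⟩
      · exact Or.inr ⟨_, le_rfl, h⟩

theorem run_stage (k : ℕ) {s : Label → Bool} (hs : ∀ i, 1 ≤ i → i < 2 ^ k → s (heap i) = false)
    (hr : s (root k) = false) :
    (run (stage k) s (root k) = true ↔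
      (∀ i, 2 ^ k ≤ i → i < 2 ^ (k + 1) → s (heap i) = true) ∧ s (root (k + 1)) = true) ∧
    (run (stage k) s (root k) = true → run (stage k) s (root (k + 1)) = false ∧
      ∀ i, 1 ≤ i → i < 2 ^ (k + 1) → run (stage k) s (heap i) = false) := by
  have hpos : 0 < 2 ^ k := by positivity
  have hpow : 2 ^ (k + 1) = 2 * 2 ^ k := by ring
  obtain ⟨h1, h2⟩ := run_heapCircuit heap_injective (2 ^ k - 1) (s := s)
    fun i h1 h2 => hs i h1 (by omega)
  have h3 : (∀ i, 2 ^ k - 1 < i → i ≤ 2 * (2 ^ k - 1) + 1 → s (heap i) = true) ↔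
      ∀ i, 2 ^ k ≤ i → i < 2 ^ (k + 1) → s (heap i) = true :=
    forall_congr' fun i => by
      rw [show 2 ^ k - 1 < i ↔ 2 ^ k ≤ i by omega,
        show i ≤ 2 * (2 ^ k - 1) + 1 ↔ i < 2 ^ (k + 1) by omega]
  rw [h3] at h1 h2
  have h4 : ∀ j, run (heapCircuit heap (2 ^ k - 1)) s (root j) = s (root j) := fun j =>
    run_heapCircuit_of_ne _ (by simp)
  simp only [stage, run_append]
  simp only [run_collect (by simp : heap 1 ≠ root (k + 1)) (by simp : heap 1 ≠ root k)
    (by simp : root (k + 1) ≠ root k), h4, hr, if_true, Bool.false_xor, Bool.and_eq_true, h1,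
    reduceCtorEq, if_false, root.injEq, Nat.succ_ne_self, or_true, heap.injEq, or_false, false_or]
  refine ⟨trivial, fun ⟨H1, H2⟩ => ⟨by rw [H2]; rfl, fun i hi1 hi2 => ?_⟩⟩
  split_ifs with hi
  · rw [hi, h1.2 H1]; rfl
  · exact h2 H1 i (by omega) (by omega)

/-- The second part supplies the zero bits that `run_stage` requires, but only when all earlier
roots are one. This suffices: later stages leave earlier roots alone, so a root that is zero makes
both sides of the equivalence false. -/
theorem run_stages (K : ℕ) {s : Label → Bool} (hs : s (root 0) = false) :
    ((∀ k < K, run (stages K) s (root k) = true) ↔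
      (∀ i, 1 ≤ i → i < 2 ^ K → s (heap i) = true) ∧
        ∀ k, 1 ≤ k → k ≤ K → s (root k) = true) ∧
    ((∀ k < K, run (stages K) s (root k) = true) → run (stages K) s (root K) = false ∧
      ∀ i, 1 ≤ i → i < 2 ^ K → run (stages K) s (heap i) = false) := by
  induction K with
  | zero =>
    refine ⟨⟨fun _ => ⟨fun i h1 h2 => ?_, fun i h1 h2 => by omega⟩, fun _ k h => by omega⟩,
      fun _ => ⟨hs, fun i h1 h2 => ?_⟩⟩ <;>
    · simp at h2; omega
  | succ K ih =>
    obtain ⟨ih1, ih2⟩ := ih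
    have hpow : 2 ^ (K + 1) = 2 * 2 ^ K := by ring
    rw [stages, run_append]
    set s' := run (stages K) s with hs'
    have hold : ∀ k < K, run (stage K) s' (root k) = s' (root k) := fun k hk => by
      refine run_of_notMem _ _ fun g hg hmem => ?_
      have := mem_wires_of_mem_stage hg hmem
      simp at this
      omega
    have hnew : ∀ l, (∀ i, l = heap i → 2 ^ K ≤ i) → (∀ k, l = root k → K < k) → s' l = s l := by
      intro l h1 h2
      refine run_of_notMem _ _ fun g hg hmem => ?_
      rcases mem_wires_of_mem_stages hg hmem with ⟨i, h3, h4, h5⟩ | ⟨k, h3, h4⟩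
      · have := h1 i h5; omega
      · have := h2 k h4; omega
    have hroot : s' (root (K + 1)) = s (root (K + 1)) :=
      hnew _ (by simp) (by simp)
    have hheap : ∀ i, 2 ^ K ≤ i → s' (heap i) = s (heap i) := fun i hi =>
      hnew _ (by simp [hi]) (by simp)
    have hsplit : (∀ k < K + 1, run (stage K) s' (root k) = true) ↔
        (∀ k < K, s' (root k) = true) ∧ run (stage K) s' (root K) = true := by
      constructor
      · exact fun H => ⟨fun k hk => by rw [← hold k hk]; exact H k (by omega), H K (by omega)⟩
      · intro H k hk
        rcases Nat.lt_succ_iff_lt_or_eq.1 hk with h | rfl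
        · rw [hold k h]; exact H.1 k h
        · exact H.2
    have hmain : (∀ k < K, s' (root k) = true) →
        (run (stage K) s' (root K) = true ↔
          (∀ i, 2 ^ K ≤ i → i < 2 ^ (K + 1) → s (heap i) = true) ∧ s (root (K + 1)) = true) := by
      intro H
      rw [(run_stage K (ih2 H).2 (ih2 H).1).1, hroot]
      refine and_congr_left fun _ => forall_congr' fun i => forall_congr' fun hi => ?_
      rw [hheap i hi]
    rw [hsplit]
    refine ⟨?_, fun H => (run_stage K (ih2 H.1).2 (ih2 H.1).1).2 H.2⟩
    constructor
    · intro ⟨H1, H2⟩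
      obtain ⟨a1, a2⟩ := ih1.1 H1
      obtain ⟨b1, b2⟩ := (hmain H1).1 H2
      refine ⟨fun i h1 h2 => ?_, fun k h1 h2 => ?_⟩
      · by_cases h : i < 2 ^ K
        · exact a1 i h1 h
        · exact b1 i (by omega) h2
      · by_cases h : k ≤ K
        · exact a2 k h1 h
        · rw [show k = K + 1 by omega]; exact b2
    · intro ⟨H1, H2⟩
      have H := ih1.2 ⟨fun i h1 h2 => H1 i h1 (by omega), fun k h1 h2 => H2 k h1 (by omega)⟩
      have hpos : 0 < 2 ^ K := by positivity
      exact ⟨H, (hmain H).2 ⟨fun i h1 h2 => H1 i (by omega) h2, H2 _ (by omega) le_rfl⟩⟩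

theorem length_stages_le (K : ℕ) : (stages K).length ≤ 3 * 2 ^ K := by
  induction K with
  | zero => simp [stages]
  | succ K ih =>
    have hpow : 2 ^ (K + 1) = 2 * 2 ^ K := by ring
    have hpos : 0 < 2 ^ K := by positivity
    simp only [stages, stage, List.length_append, length_heapCircuit, collect, List.length_cons,
      List.length_nil]
    omega

theorem log_lt_of_lt_two_pow {i k : ℕ} (h : i < 2 ^ k) (hi : 1 ≤ i) : Nat.log 2 i < k :=
  (Nat.log_lt_iff_lt_pow (by norm_num) (by omega)).2 h

/-- The tree of a stage raises the weighted bound by 4. Its leaves are fresh wires, available at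
time zero, and their weight is at most `2 * K`, within the allowance `4 * K + 1`. -/
theorem finish_stages_le (K : ℕ) :
    (∀ i, 1 ≤ i → i < 2 ^ K → finish (fun _ => 0) (stages K) (heap i) + 2 * Nat.log 2 i ≤ 4 * K) ∧
      ∀ k ≤ K, finish (fun _ => 0) (stages K) (root k) ≤ 4 * K + 1 := by
  induction K with
  | zero =>
    refine ⟨fun i h1 h2 => ?_, fun k _ => by simp [stages]⟩
    simp at h2
    omega
  | succ K ih =>
    obtain ⟨ih1, ih2⟩ := ih
    have hpow : 2 ^ (K + 1) = 2 * 2 ^ K := by ring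
    have hpos : 0 < 2 ^ K := by positivity
    rw [stages, finish_append]
    set τ := finish (fun _ => 0) (stages K) with hτ
    have hnew : ∀ l, (∀ i, l = heap i → 2 ^ K ≤ i) → (∀ k, l = root k → K < k) → τ l = 0 := by
      intro l h1 h2
      refine finish_of_notMem _ _ fun g hg hmem => ?_
      rcases mem_wires_of_mem_stages hg hmem with ⟨i, h3, h4, h5⟩ | ⟨k, h3, h4⟩
      · have := h1 i h5; omega
      · have := h2 k h4; omega
    obtain ⟨t1, t2⟩ := finish_heapCircuit_le heap_injective (4 * K) (2 ^ K - 1) (τ := τ)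
      (fun i h1 h2 => ih1 i h1 (by omega)) (fun i h1 h2 => by
        have := log_lt_of_lt_two_pow (i := i) (k := K + 1) (by omega) (by omega)
        rw [hnew _ (by simp; omega) (by simp)]
        omega)
    have hroots : ∀ k, finish τ (heapCircuit heap (2 ^ K - 1)) (root k) = τ (root k) := fun k => by
      refine finish_of_notMem _ _ fun g hg hmem => ?_
      obtain ⟨i, _, _, h⟩ := mem_wires_of_mem_heapCircuit hg hmem
      cases h
    rw [stage, finish_append]
    set τ' := finish τ (heapCircuit heap (2 ^ K - 1)) with hτ'
    have hcollect : ∀ l, l ≠ heap 1 → l ≠ root (K + 1) → l ≠ root K →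
        finish τ' (collect (heap 1) (root (K + 1)) (root K)) l = τ' l := fun l h1 h2 h3 => by
      refine finish_of_notMem _ _ fun g hg hmem => ?_
      have := mem_wires_of_mem_collect hg hmem
      tauto
    obtain ⟨c1, c2, c3⟩ := finish_collect_le (u := heap 1) (v := root (K + 1)) (w := root K)
      (by simp) (by simp) (by simp) (τ := τ') (T := 4 * K + 1) t1
      (by rw [hroots, hnew _ (by simp) (by simp)]; omega) (by rw [hroots]; exact ih2 K le_rfl)
    refine ⟨fun i h1 h2 => ?_, fun k hk => ?_⟩
    · by_cases hi : i = 1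
      · rw [hi]; simp; omega
      · rw [hcollect _ (by simpa using hi) (by simp) (by simp)]
        have := t2 i (by omega) (by omega)
        omega
    · by_cases h1 : k = K + 1
      · rw [h1]; omega
      by_cases h2 : k = K
      · rw [h2]; omega
      rw [hcollect _ (by simp) (by simpa using h1) (by simpa using h2), hroots]
      have := ih2 k (by omega)
      omega

/-! ### Reduction of all controls to logarithmically many live bits. -/

/-- The bits of the conjunction tree over the last `m` controls. -/
def lastHeap (m i : ℕ) : Label := if i < m then heap i else leaf i

theorem lastHeap_injective (m : ℕ) : Function.Injective (lastHeap m) := by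
  intro i j h
  unfold lastHeap at h
  split_ifs at h <;> simpa using h

/-- Reduction of the conjunction of all controls to that of `liveBits K m`. -/
def reduceCircuit (K m : ℕ) : List (BitGate Label) := stages K ++ heapCircuit (lastHeap m) (m - 1)

/-- The bits that carry the conjunction of all controls after `reduceCircuit K m`. -/
def liveBits (K m : ℕ) : List Label :=
  (if m = 0 then [] else [lastHeap m 1]) ++ (List.range K).map root

theorem mem_wires_of_mem_reduceCircuit {K m : ℕ} (hm : m ≤ 2 ^ K) {g : BitGate Label}
    (hg : g ∈ reduceCircuit K m) {l : Label} (hl : l ∈ g.wires) :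
    (∃ i, 1 ≤ i ∧ i < 2 ^ K ∧ l = heap i) ∨ (∃ k ≤ K, l = root k) ∨
      ∃ i, m ≤ i ∧ i < 2 * m ∧ l = leaf i := by
  rw [reduceCircuit, List.mem_append] at hg
  rcases hg with hg | hg
  · rcases mem_wires_of_mem_stages hg hl with h | h
    · exact Or.inl h
    · exact Or.inr (Or.inl h)
  · rcases Nat.eq_zero_or_pos m with rfl | hm0
    · simp [heapCircuit] at hg
    · obtain ⟨i, h1, h2, h3⟩ := mem_wires_of_mem_heapCircuit hg hl
      rw [lastHeap] at h3
      split_ifs at h3 with h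
      · exact Or.inl ⟨i, h1, by omega, h3⟩
      · exact Or.inr (Or.inr ⟨i, by omega, by omega, h3⟩)

/-- The last tree needs `m - 1` zero bits; these are among the `2 ^ K - 1` cleared ones, provided
that all roots are one. Otherwise both sides already fail. -/
theorem run_reduceCircuit {K m : ℕ} (hm : m ≤ 2 ^ K) {s : Label → Bool}
    (hs : s (root 0) = false) :
    (∀ l ∈ liveBits K m, run (reduceCircuit K m) s l = true) ↔
      (∀ i, 1 ≤ i → i < 2 ^ K → s (heap i) = true) ∧
      (∀ k, 1 ≤ k → k ≤ K → s (root k) = true) ∧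
        ∀ i, m ≤ i → i < 2 * m → s (leaf i) = true := by
  obtain ⟨h1, h2⟩ := run_stages K hs
  rw [reduceCircuit, run_append]
  set s' := run (stages K) s with hs'
  have hroots : ∀ k, run (heapCircuit (lastHeap m) (m - 1)) s' (root k) = s' (root k) := fun k =>
    run_heapCircuit_of_ne _ fun i _ _ => by unfold lastHeap; split_ifs <;> simp
  have hleaf : ∀ i, s' (leaf i) = s (leaf i) := fun i => by
    refine run_of_notMem _ _ fun g hg hmem => ?_
    have := mem_wires_of_mem_stages hg hmem
    simp at this
  have hlive : (∀ l ∈ liveBits K m, run (heapCircuit (lastHeap m) (m - 1)) s' l = true) ↔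
      (∀ k < K, s' (root k) = true) ∧
        (m ≠ 0 → run (heapCircuit (lastHeap m) (m - 1)) s' (lastHeap m 1) = true) := by
    simp only [liveBits, List.mem_append, List.mem_map, List.mem_range]
    constructor
    · intro H
      refine ⟨fun k hk => ?_, fun hm0 => H _ (Or.inl (by simp [hm0]))⟩
      rw [← hroots]
      exact H _ (Or.inr ⟨k, hk, rfl⟩)
    · rintro ⟨H1, H2⟩ l (hl | ⟨k, hk, rfl⟩)
      · split_ifs at hl with hm0
        · simp at hl
        · rw [List.mem_singleton.1 hl]; exact H2 hm0
      · rw [hroots]; exact H1 k hk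
  rw [hlive, ← and_assoc, ← h1]
  refine and_congr_right fun H => ?_
  rcases Nat.eq_zero_or_pos m with rfl | hm0
  · simp
  · have hz : ∀ i, 1 ≤ i → i ≤ m - 1 → s' (lastHeap m i) = false := fun i hi1 hi2 => by
      rw [lastHeap, if_pos (by omega)]
      exact (h2 H).2 i hi1 (by omega)
    rw [(run_heapCircuit (lastHeap_injective m) (m - 1) hz).1]
    constructor
    · intro H' i hi1 hi2
      have := H' hm0.ne' i (by omega) (by omega)
      rwa [lastHeap, if_neg (by omega), hleaf] at this
    · intro H' _ i hi1 hi2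
      rw [lastHeap, if_neg (by omega), hleaf]
      exact H' i (by omega) (by omega)

theorem finish_reduceCircuit_le {K m : ℕ} (hm : m ≤ 2 ^ K) (l : Label) :
    finish (fun _ => 0) (reduceCircuit K m) l ≤ 4 * K + 4 := by
  obtain ⟨h1, h2⟩ := finish_stages_le K
  have hpow : 2 ^ (K + 1) = 2 * 2 ^ K := by ring
  rw [reduceCircuit, finish_append]
  set τ := finish (fun _ => 0) (stages K) with hτ
  have hall : ∀ l, τ l ≤ 4 * K + 1 := by
    intro l
    by_cases h : ∀ g ∈ stages K, l ∉ g.wires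
    · rw [hτ, finish_of_notMem _ _ h]; omega
    · push Not at h
      obtain ⟨g, hg, hl⟩ := h
      rcases mem_wires_of_mem_stages hg hl with ⟨i, h3, h4, rfl⟩ | ⟨k, h3, rfl⟩
      · have := h1 i h3 h4; omega
      · exact h2 k h3
  rcases Nat.eq_zero_or_pos m with rfl | hm0
  · exact (hall l).trans (by omega)
  · obtain ⟨t1, t2⟩ := finish_heapCircuit_le (lastHeap_injective m) (4 * K) (m - 1) (τ := τ)
      (fun i hi1 hi2 => by
        rw [lastHeap, if_pos (by omega)]
        exact h1 i hi1 (by omega))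
      (fun i hi1 hi2 => by
        have := log_lt_of_lt_two_pow (i := i) (k := K + 1) (by omega) (by omega)
        rw [lastHeap, if_neg (by omega), hτ, finish_of_notMem _ _ fun g hg hmem => by
          have := mem_wires_of_mem_stages hg hmem
          simp at this]
        omega)
    by_cases h : ∀ g ∈ heapCircuit (lastHeap m) (m - 1), l ∉ g.wires
    · rw [finish_of_notMem _ _ h]
      exact (hall l).trans (by omega)
    · push Not at h
      obtain ⟨g, hg, hl⟩ := h
      obtain ⟨i, h3, h4, rfl⟩ := mem_wires_of_mem_heapCircuit hg hl
      by_cases hi : i = 1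
      · rw [hi]; omega
      · have := t2 i (by omega) h4
        omega

/-! ### The complete classical circuit: compute, change the target, uncompute. -/

/-- Bits borrowed while the target is changed. -/
def borrowedBits (K : ℕ) : List Label := root K :: (List.range (K - 1)).map fun i => heap (i + 2)

/-- The classical circuit for the Toffoli gate. -/
def toffoliCircuit (K m : ℕ) : List (BitGate Label) :=
  reduceCircuit K m ++ multiControlledNot target (liveBits K m) (borrowedBits K) ++
    (reduceCircuit K m).reverse

theorem length_liveBits_le (K m : ℕ) : (liveBits K m).length ≤ K + 1 := by
  unfold liveBits
  split_ifs <;> simp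

theorem nodup_liveBits_borrowedBits (K m : ℕ) :
    (target :: (liveBits K m ++ borrowedBits K)).Nodup := by
  have hr : Function.Injective root := fun _ _ h => by cases h; rfl
  have hh : Function.Injective fun i => heap (i + 2) := fun _ _ h => by cases h; rfl
  have h1 := (List.nodup_range (n := K)).map hr
  have h2 := (List.nodup_range (n := K - 1)).map hh
  unfold liveBits borrowedBits lastHeap
  split_ifs <;> simp [List.nodup_append, h1, h2] <;> grind

theorem run_toffoliCircuit {K m : ℕ} (hm : m ≤ 2 ^ K) {s : Label → Bool}
    (hs : s (root 0) = false) :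
    run (toffoliCircuit K m) s = Function.update s target (xor (s target)
      (decide ((∀ i, 1 ≤ i → i < 2 ^ K → s (heap i) = true) ∧
        (∀ k, 1 ≤ k → k ≤ K → s (root k) = true) ∧
        ∀ i, m ≤ i → i < 2 * m → s (leaf i) = true))) := by
  have htarget : ∀ g ∈ reduceCircuit K m, target ∉ g.wires := fun g hg hmem => by
    have := mem_wires_of_mem_reduceCircuit hm hg hmem
    simp at this
  -- There are `K` borrowed bits (one if `K = 0`) for at most `K + 1` live bits.
  have hlen : (liveBits K m).length ≤ (borrowedBits K).length + 1 := by
    have := length_liveBits_le K m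
    simp [borrowedBits]
    omega
  rw [toffoliCircuit, run_append, run_append,
    run_multiControlledNot (nodup_liveBits_borrowedBits K m) hlen, run_update _ _ (by simpa),
    run_reverse_run, run_of_notMem _ _ htarget]
  congr 2
  rw [Bool.eq_iff_iff, List.all_eq_true, decide_eq_true_iff]
  exact run_reduceCircuit hm hs

theorem mem_wires_of_mem_toffoliCircuit {K m : ℕ} (hm : m ≤ 2 ^ K) {g : BitGate Label}
    (hg : g ∈ toffoliCircuit K m) {l : Label} (hl : l ∈ g.wires) :
    (∃ i, 1 ≤ i ∧ i < 2 ^ K ∧ l = heap i) ∨ (∃ k ≤ K, l = root k) ∨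
      (∃ i, m ≤ i ∧ i < 2 * m ∧ l = leaf i) ∨ l = target := by
  have hK : K < 2 ^ K := Nat.lt_two_pow_self
  simp only [toffoliCircuit, List.mem_append, List.mem_reverse] at hg
  rcases hg with (hg | hg) | hg
  · exact (mem_wires_of_mem_reduceCircuit hm hg hl).imp_right (Or.imp_right Or.inl)
  · rcases mem_wires_of_mem_multiControlledNot hg hl with h | h | h
    · tauto
    · simp only [liveBits, List.mem_append, List.mem_map, List.mem_range] at h
      rcases h with h | ⟨k, hk, rfl⟩
      · split_ifs at h with h0
        · simp at h
        · rw [List.mem_singleton, lastHeap] at h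
          split_ifs at h with h1
          · exact Or.inl ⟨1, le_rfl, by omega, h⟩
          · exact Or.inr (Or.inr (Or.inl ⟨1, by omega, by omega, h⟩))
      · exact Or.inr (Or.inl ⟨k, hk.le, rfl⟩)
    · simp only [borrowedBits, List.mem_cons, List.mem_map, List.mem_range] at h
      rcases h with rfl | ⟨i, hi, rfl⟩
      · exact Or.inr (Or.inl ⟨K, le_rfl, rfl⟩)
      · exact Or.inl ⟨i + 2, by omega, by omega, rfl⟩
  · exact (mem_wires_of_mem_reduceCircuit hm hg hl).imp_right (Or.imp_right Or.inl)

theorem length_toffoliCircuit_le {K m : ℕ} (hm : m ≤ 2 ^ K) :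
    (toffoliCircuit K m).length ≤ 24 * 2 ^ K := by
  have h1 := length_stages_le K
  have h2 := length_multiControlledNot_le target (liveBits K m) (borrowedBits K)
  have h3 := length_liveBits_le K m
  have hK : K < 2 ^ K := Nat.lt_two_pow_self
  simp only [toffoliCircuit, reduceCircuit, List.length_append, List.length_reverse,
    length_heapCircuit]
  omega

theorem finish_toffoliCircuit_le {K m : ℕ} (hm : m ≤ 2 ^ K) (l : Label) :
    finish (fun _ => 0) (toffoliCircuit K m) l ≤ 12 * K + 16 := by
  have h1 := length_multiControlledNot_le target (liveBits K m) (borrowedBits K)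
  have h2 := length_liveBits_le K m
  rw [toffoliCircuit, finish_append, finish_append]
  have h3 := finish_le_add_length (finish_reduceCircuit_le hm)
    (multiControlledNot target (liveBits K m) (borrowedBits K))
  -- The deadline is `4 * K + 4` for each of the two reductions plus `4 * K + 8` for the ladder,
  -- which is run serially.
  have h4 := finish_reverse_add_le (τ := fun _ => 0) (D := 12 * K + 16) (reduceCircuit K m)
    (fun w => Nat.add_le_add (h3 w) (finish_reduceCircuit_le hm w) |>.trans (by omega)) l
  simpa using h4

/-! ### From labelled bits to the register of `n + 2` qubits. -/

/-- By linearity it is enough to know the action on basis states whose ancillas are zero. -/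
theorem basisMap_mulVec_withZeros {Q A : Type} [Fintype Q] [DecidableEq Q] [Fintype A]
    [DecidableEq A] {f : (Q ⊕ A → Bool) → Q ⊕ A → Bool} {F : (Q → Bool) → Q → Bool}
    (h : ∀ q, f (Sum.elim q fun _ => false) = Sum.elim (F q) fun _ => false)
    (ψ : (Q → Bool) → ℂ) :
    (basisMap f).mulVec (withZeros ψ) = withZeros ((basisMap F).mulVec ψ) := by
  have hz : ∀ x : Q ⊕ A → Bool, (∀ a, x (Sum.inr a) = false) →
      x = Sum.elim (fun q => x (Sum.inl q)) fun _ => false := fun x hx => by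
    ext (q | a)
    · rfl
    · exact hx a
  have hy : ∀ (y : Q ⊕ A → Bool) (q : Q → Bool), y = (Sum.elim (F q) fun _ => false) ↔
      (∀ a, y (Sum.inr a) = false) ∧ (fun q => y (Sum.inl q)) = F q := by
    refine fun y q => ⟨?_, fun ⟨h1, h2⟩ => (hz y h1).trans (by rw [h2])⟩
    rintro rfl
    exact ⟨fun _ => rfl, rfl⟩
  ext y
  have hsum : (basisMap f).mulVec (withZeros ψ) y =
      ∑ q : Q → Bool, if y = (Sum.elim (F q) fun _ => false) then ψ q else 0 := by
    simp only [Matrix.mulVec, dotProduct, basisMap, Matrix.of_apply, withZeros, mul_ite, mul_zero]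
    rw [← Finset.sum_filter]
    refine Finset.sum_bij' (fun x _ q => x (Sum.inl q)) (fun q _ => Sum.elim q fun _ => false)
      ?_ ?_ ?_ ?_ ?_
    · simp
    · simp
    · intro x hx
      exact (hz x (by simpa using hx)).symm
    · simp
    · intro x hx
      rw [← h, ← hz x (by simpa using hx)]
      simp
  rw [hsum]
  simp only [hy, withZeros, Matrix.mulVec, dotProduct, basisMap, Matrix.of_apply]
  split_ifs with h0
  · simp [h0]
  · simp [h0]

/-- The summands count the tree controls of the `K` full stages, the controls used as roots, and the
leaves of the last tree. When the last tree is full, its `2 ^ K` leaves and one more root make a new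
stage. -/
theorem exists_two_pow_decomposition (n : ℕ) :
    ∃ K m : ℕ, m ≤ 2 ^ K ∧ n = 2 ^ K - 1 + K + m := by
  induction n with
  | zero => exact ⟨0, 0, by simp, by simp⟩
  | succ n ih =>
    obtain ⟨K, m, hm, rfl⟩ := ih
    rcases hm.lt_or_eq with h | rfl
    · exact ⟨K, m + 1, h, rfl⟩
    · refine ⟨K + 1, 0, Nat.zero_le _, ?_⟩
      have hpos : 0 < 2 ^ K := by positivity
      have hpow : 2 ^ (K + 1) = 2 * 2 ^ K := by ring
      omega

/-- The position of each wire of the `n`-Toffoli circuit, `n = 2 ^ K - 1 + K + m`. -/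
def wireLabel (K m : ℕ) {n : ℕ} : Fin (n + 1) ⊕ Fin 1 → Label
  | .inl i => if i.val < 2 ^ K - 1 then heap (i + 1)
      else if i.val < 2 ^ K - 1 + K then root (i - (2 ^ K - 1) + 1)
      else if i.val < n then leaf (m + (i - (2 ^ K - 1 + K))) else target
  | .inr _ => root 0

section WireLabel

variable {K m n : ℕ}

theorem wireLabel_injective : Function.Injective (wireLabel K m (n := n)) := by
  rintro (i | i) (j | j) h
  · congr 1
    ext
    have := i.isLt
    have := j.isLt
    simp only [wireLabel] at h
    split_ifs at h <;> simp only [heap.injEq, root.injEq, leaf.injEq] at h <;> omega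
  · simp only [wireLabel] at h
    split_ifs at h
    simp at h
  · simp only [wireLabel] at h
    split_ifs at h
    simp at h
  · rw [Subsingleton.elim i j]

theorem wireLabel_last (hn : n = 2 ^ K - 1 + K + m) :
    wireLabel K m (.inl (Fin.last n)) = target := by
  simp only [wireLabel, Fin.val_last]
  rw [if_neg (by omega), if_neg (by omega), if_neg (by omega)]

theorem exists_wireLabel_heap (hn : n = 2 ^ K - 1 + K + m) {i : ℕ} (h1 : 1 ≤ i) (h2 : i < 2 ^ K) :
    ∃ j : Fin n, wireLabel K m (.inl j.castSucc) = heap i := by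
  refine ⟨⟨i - 1, by omega⟩, ?_⟩
  simp only [wireLabel, Fin.val_castSucc]
  rw [if_pos (by omega)]
  congr 1
  omega

theorem exists_wireLabel_root (hn : n = 2 ^ K - 1 + K + m) {k : ℕ} (h1 : 1 ≤ k) (h2 : k ≤ K) :
    ∃ j : Fin n, wireLabel K m (.inl j.castSucc) = root k := by
  refine ⟨⟨2 ^ K - 1 + (k - 1), by omega⟩, ?_⟩
  simp only [wireLabel, Fin.val_castSucc]
  rw [if_neg (by omega), if_pos (by omega)]
  congr 1
  omega

theorem exists_wireLabel_leaf (hn : n = 2 ^ K - 1 + K + m) {i : ℕ} (h1 : m ≤ i) (h2 : i < 2 * m) :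
    ∃ j : Fin n, wireLabel K m (.inl j.castSucc) = leaf i := by
  refine ⟨⟨2 ^ K - 1 + K + (i - m), by omega⟩, ?_⟩
  simp only [wireLabel, Fin.val_castSucc]
  rw [if_neg (by omega), if_neg (by omega), if_pos (by omega)]
  congr 1
  omega

theorem forall_wireLabel_iff (hn : n = 2 ^ K - 1 + K + m) (s : Label → Bool) :
    ((∀ i, 1 ≤ i → i < 2 ^ K → s (heap i) = true) ∧ (∀ k, 1 ≤ k → k ≤ K → s (root k) = true) ∧
        ∀ i, m ≤ i → i < 2 * m → s (leaf i) = true) ↔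
      ∀ j : Fin n, s (wireLabel K m (.inl j.castSucc)) = true := by
  constructor
  · rintro ⟨H1, H2, H3⟩ j
    have := j.isLt
    simp only [wireLabel, Fin.val_castSucc]
    split_ifs
    · exact H1 _ (by omega) (by omega)
    · exact H2 _ (by omega) (by omega)
    · exact H3 _ (by omega) (by omega)
  · intro H
    refine ⟨fun i h1 h2 => ?_, fun k h1 h2 => ?_, fun i h1 h2 => ?_⟩
    · obtain ⟨j, hj⟩ := exists_wireLabel_heap hn h1 h2
      rw [← hj]; exact H j
    · obtain ⟨j, hj⟩ := exists_wireLabel_root hn h1 h2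
      rw [← hj]; exact H j
    · obtain ⟨j, hj⟩ := exists_wireLabel_leaf hn h1 h2
      rw [← hj]; exact H j

theorem exists_toffoliCircuit_eq_map (hm : m ≤ 2 ^ K) (hn : n = 2 ^ K - 1 + K + m) :
    ∃ C : List (BitGate (Fin (n + 1) ⊕ Fin 1)),
      C.map (BitGate.map (wireLabel K m)) = toffoliCircuit K m := by
  refine exists_map_eq _ fun g hg w hw => ?_
  rcases mem_wires_of_mem_toffoliCircuit hm hg hw with
    ⟨i, h1, h2, rfl⟩ | ⟨k, h1, rfl⟩ | ⟨i, h1, h2, rfl⟩ | rfl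
  · obtain ⟨j, hj⟩ := exists_wireLabel_heap hn h1 h2
    exact ⟨_, hj⟩
  · rcases Nat.eq_zero_or_pos k with rfl | hk
    · exact ⟨.inr 0, rfl⟩
    · obtain ⟨j, hj⟩ := exists_wireLabel_root hn hk h1
      exact ⟨_, hj⟩
  · obtain ⟨j, hj⟩ := exists_wireLabel_leaf hn h1 h2
    exact ⟨_, hj⟩
  · exact ⟨_, wireLabel_last hn⟩

end WireLabel

theorem exists_implementsClean_toffoli (n : ℕ) :
    ∃ C : Circuit (Fin (n + 1) ⊕ Fin 1), C.ImplementsClean (toffoli n) ∧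
      C.depth ≤ 228 * Nat.log 2 (n + 1) + 304 ∧ C.size ≤ 456 * (n + 1) := by
  obtain ⟨K, m, hm, hn⟩ := exists_two_pow_decomposition n
  have hpow : 2 ^ K ≤ n + 1 := by omega
  have hK : K ≤ Nat.log 2 (n + 1) := Nat.le_log_of_pow_le (by norm_num) hpow
  obtain ⟨C, hC⟩ := exists_toffoliCircuit_eq_map hm hn
  have hinj : Function.Injective (wireLabel K m (n := n)) := wireLabel_injective
  refine ⟨compile C, fun ψ => ?_, ?_, ?_⟩
  · rw [compile_matrix]
    refine basisMap_mulVec_withZeros (fun q => ?_) ψ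
    set x : Fin (n + 1) ⊕ Fin 1 → Bool := Sum.elim q fun _ => false with hx
    -- The default value on labels outside the register is immaterial, since states are compared
    -- only on the range of `wireLabel`.
    have hs : ∀ w, Function.extend (wireLabel K m) x (fun _ => false) (wireLabel K m w) = x w :=
      hinj.extend_apply x _
    set s := Function.extend (wireLabel K m) x fun _ => false
    have hrun := run_map hinj C s
    rw [hC, run_toffoliCircuit hm (hs (.inr 0)), show s ∘ wireLabel K m = x from funext hs] at hrun
    rw [← hrun]
    ext w
    rw [Function.comp_apply, ← wireLabel_last hn]
    simp only [forall_wireLabel_iff hn s, hs, Function.update_apply, hinj.eq_iff]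
    rcases w with i | i
    · simp [hx, Function.update_apply]
    · simp [hx]
  · refine (compile_depth_le C (T := 12 * K + 16) fun w => ?_).trans (by omega)
    have hfin := congrFun (finish_map hinj C fun _ => 0) w
    rw [hC] at hfin
    exact hfin.symm.trans_le (finish_toffoliCircuit_le hm _)
  · have h1 := compile_length_le C
    have h2 := length_toffoliCircuit_le hm
    rw [← hC, List.length_map] at h2
    unfold Circuit.size
    omega

end QuantumCircuit

/-! ### Asymptotic bounds. -/

theorem theorem1 :
    ∃ C : (n : ℕ) → QuantumCircuit.Circuit (Fin (n + 1) ⊕ Fin 1),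
      (∀ n : ℕ, (C n).ImplementsClean (QuantumCircuit.toffoli n)) ∧
      (fun n : ℕ => ((C n).depth : ℝ)) =O[Filter.atTop] (fun n : ℕ => Real.log (n : ℝ)) ∧
      (fun n : ℕ => ((C n).size : ℝ)) =O[Filter.atTop] (fun n : ℕ => (n : ℝ)) := by
  choose C h1 h2 h3 using QuantumCircuit.exists_implementsClean_toffoli
  refine ⟨C, h1, ?_, ?_⟩
  -- From `n + 1 ≤ n ^ 2` for `n ≥ 2` the logarithm at most doubles, and `Real.log 2 ≤ Real.log n`
  -- absorbs the constant term: `760 = 2 * 228 + 304`.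
  · refine Asymptotics.IsBigO.of_bound (760 / Real.log 2) ?_
    filter_upwards [Filter.eventually_ge_atTop 2] with n hn
    have hlog2 : 0 < Real.log 2 := Real.log_pos (by norm_num)
    have hn' : (2 : ℝ) ≤ n := by exact_mod_cast hn
    have hlog : Real.log 2 ≤ Real.log n := Real.log_le_log (by norm_num) hn'
    have hsucc : (Nat.log 2 (n + 1) : ℝ) * Real.log 2 ≤ 2 * Real.log n := by
      have hpow : (2 : ℝ) ^ Nat.log 2 (n + 1) ≤ (n : ℝ) ^ 2 := by
        have : 2 ^ Nat.log 2 (n + 1) ≤ n + 1 := Nat.pow_log_le_self 2 (by omega)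
        exact_mod_cast this.trans (by nlinarith)
      have := Real.log_le_log (by positivity) hpow
      rwa [Real.log_pow, Real.log_pow, Nat.cast_ofNat] at this
    have hd : ((C n).depth : ℝ) ≤ 228 * Nat.log 2 (n + 1) + 304 := by exact_mod_cast h2 n
    rw [Real.norm_of_nonneg (by positivity), Real.norm_of_nonneg (hlog2.le.trans hlog),
      div_mul_eq_mul_div, le_div_iff₀ hlog2]
    nlinarith
  · refine Asymptotics.IsBigO.of_bound 912 ?_
    filter_upwards [Filter.eventually_ge_atTop 1] with n hn
    have hs : ((C n).size : ℝ) ≤ 456 * (n + 1) := by exact_mod_cast h3 n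
    have hn' : (1 : ℝ) ≤ n := by exact_mod_cast hn
    rw [Real.norm_of_nonneg (by positivity), Real.norm_of_nonneg (by positivity)]
    linarith
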